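/- Let $N\cong\mathbb{Z}^d$ be a lattice, $N_{\mathbb R}=N\otimes_{\mathbb Z}\mathbb R$, and let $P\subseteq N_{\mathbb R}$ be a full-dimensional lattice polytope (the convex hull of finitely many points of $N$) that contains the origin. For $\lambda\in\mathbb{Q}_{>0}$ let $\partial_{\neq0}(\lambda P)$ be the union of the facets of $\lambda P$ that do not contain the origin, and put $\partial_{\neq 0}(0\cdot P)=\{0\}$. For $n\in\mathbb{Z}_{>0}$ let $P^{\oplus n}\subseteq N_{\mathbb R}^{\,n}$ be the convex hull of the union of the $n$ copies of $P$ in the coordinate subspaces $0\times\cdots\times N_{\mathbb R}\times\cdots\times 0$, a lattice polytope with respect to $N^n=N\oplus\cdots\oplus N$. The $h^*$-polynomial $h^*(Q;t)\in\mathbb{Z}[t]$ of a lattice polytope $Q$ with respect to a lattice $N_Q$, and the weighted $h^*$-polynomial $\tilde h(P;t)$, a polynomial with integer coefficients and exponents in $\mathbb{Q}_{\ge0}$, are defined by \[ \sum_{m\ge0}\#(mQ\cap N_Q)\,t^m=\frac{h^*(Q;t)}{(1-t)^{\dim Q+1}},\qquad \sum_{\lambda\in\mathbb{Q}_{\ge0}}\#(\partial_{\ne0}(\lambda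 P)\cap N)\,t^\lambda=\frac{\tilde h(P;t)}{(1-t)^{\dim P}} . \] Let $P^\vee=\{u\in \operatorname{Hom}(N,\mathbb Z)_{\mathbb R}\mid\langle u,v\rangle\ge-1\text{ for all }v\in P\}$, and let $r_P$ be the least integer $r>0$ such that $rP^\vee$ is a lattice polyhedron, i.e. has all its vertices in $\operatorname{Hom}(N,\mathbb{Z})$. Then $\tilde h(P;t)$, $h^*(P^{\oplus n};t)$ (for all $n>0$) and $r_P$ exist, and the following hold. (1) For every $n\in\mathbb{Z}_{>0}$ and every real $x>0$, \[ h^*(P^{\oplus n};x)\le\tilde h(P;x)^n\le x^{\frac1{r_P}-1}\,h^*(P^{\oplus n};x)\quad\text{if }0<x\le1, \] \[ \tilde h(P;x)^n\le h^*(P^{\oplus n};x)\le x^{1-\frac1{r_P}}\,\tilde h(P;x)^n\quad\text{if }x\ge1. \] (2) For every real $x>0$, $\tilde h(P;x)=\lim_{n\to\infty}h^*(P^{\oplus n};x)^{1/n}$. (3) $\tilde h(P;t)$ determines and is determined by $\{h^*(P^{\oplus n};t)\mid n\in\mathbb{Z}_{>0}\}$. That is, if $P'$ is another full-dimensional lattice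 polytope containing the origin, with respect to a lattice $N'$ of any rank, then $\tilde h(P;t)=\tilde h(P';t)$ if and only if $h^*(P^{\oplus n};t)=h^*(P'^{\oplus n};t)$ for all $n>0$, and also if and only if the sets $\{h^*(P^{\oplus n};t)\mid n>0\}$ and $\{h^*(P'^{\oplus n};t)\mid n>0\}$ are equal. (4) With $P'$ and $N'$ as in (3), the following are equivalent: (a) $\#(\lambda P\cap N)=\#(\lambda P'\cap N')$ for all $\lambda\in\mathbb{Q}_{\ge0}$; (b) $\dim P=\dim P'$ and $\tilde h(P;t)=\tilde h(P';t)$; (c) $\#(mP^{\oplus n}\cap N^n)=\#(mP'^{\oplus n}\cap N'^n)$ for all $m\in\mathbb{Z}_{\ge0}$ and $n\in\mathbb{Z}_{>0}$. -/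

import Mathlib

open scoped Pointwise Topology NNRat

noncomputable section

namespace FreeSum

/-- The number of points of the lattice `L` in the set `S`. -/
def latticeCount {E : Type*} [AddCommGroup E] (L : Submodule ℤ E) (S : Set E) : ℕ :=
  (S ∩ (L : Set E)).ncard

/-- The dimension of a polytope: the dimension of the direction space of its affine span. -/
def polyDim {E : Type*} [AddCommGroup E] [Module ℝ E] (P : Set E) : ℕ :=
  Module.finrank ℝ (vectorSpan ℝ P)

/-- `P` is a full-dimensional polytope with vertices in the lattice `L`, and contains the origin. -/
structure IsFullLatticePolytope {E : Type*} [AddCommGroup E] [Module ℝ E]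
    (L : Submodule ℤ E) (P : Set E) : Prop where
  exists_conv : ∃ S : Finset E, (S : Set E) ⊆ (L : Set E) ∧ P = convexHull ℝ (S : Set E)
  affineSpan_eq_top : affineSpan ℝ P = ⊤
  zero_mem : (0 : E) ∈ P

/-- `F` is a facet of the polytope `P`: a (nonempty) face, cut out by a supporting hyperplane, of
dimension one less than `P`. -/
structure IsFacet {E : Type*} [NormedAddCommGroup E] [NormedSpace ℝ E] (P F : Set E) : Prop where
  nonempty : F.Nonempty
  isExposed : IsExposed ℝ P F
  dim_eq : polyDim F + 1 = polyDim P

/-- The set `∂_{≠ 0}(lam • P)`: the union of the facets of the dilate `lam • P` that do not contain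
the origin. For `lam = 0` the dilate is the origin, and the usual convention `∂_{≠ 0}(0 • P) = {0}`
is made. -/
def awayBoundary {E : Type*} [NormedAddCommGroup E] [NormedSpace ℝ E] (P : Set E) (lam : ℚ≥0) :
    Set E :=
  if lam = 0 then {0} else {v | ∃ F : Set E, IsFacet ((lam : ℝ) • P) F ∧ (0 : E) ∉ F ∧ v ∈ F}

/-- The Ehrhart series `∑_{m ≥ 0} #(m P ∩ L) t ^ m`. -/
def ehrhartSeries {E : Type*} [AddCommGroup E] [Module ℝ E] (L : Submodule ℤ E) (P : Set E) :
    PowerSeries ℤ :=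
  PowerSeries.mk fun m => (latticeCount L ((m : ℝ) • P) : ℤ)

/-- `p` is the `h^*`-polynomial of `P`:
`p = (1 - t) ^ (dim P + 1) * ∑_{m ≥ 0} #(m P ∩ L) t ^ m`. -/
def IsHStar {E : Type*} [AddCommGroup E] [Module ℝ E] (L : Submodule ℤ E) (P : Set E)
    (p : Polynomial ℤ) : Prop :=
  (p : PowerSeries ℤ) = (1 - PowerSeries.X) ^ (polyDim P + 1) * ehrhartSeries L P

open Classical in
/-- The `h^*`-polynomial of `P`, the unique polynomial with `IsHStar L P` (and `0` if there were
none). -/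
def hStar {E : Type*} [AddCommGroup E] [Module ℝ E] (L : Submodule ℤ E) (P : Set E) :
    Polynomial ℤ :=
  if h : ∃ p, IsHStar L P p then h.choose else 0

/-- Polynomials with integer coefficients and exponents in `ℚ≥0`, that is, `⋃_r ℤ[t^(1/r)]`. -/
abbrev FracPoly : Type := AddMonoidAlgebra ℤ ℚ≥0

/-- The value of a polynomial with fractional exponents at a positive real number `x`. -/
def FracPoly.evalReal (x : ℝ) (p : FracPoly) : ℝ :=
  p.coeff.sum fun j a => (a : ℝ) * x ^ (j : ℝ)

/-- The coefficients of the (Cauchy) product of a polynomial `q` with fractional exponents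
and the formal series `∑_{lam ∈ ℚ≥0} c lam * t ^ lam`. -/
def FracPoly.mulSeries (q : FracPoly) (c : ℚ≥0 → ℤ) (lam : ℚ≥0) : ℤ :=
  q.coeff.sum fun j a => if j ≤ lam then a * c (lam - j) else 0

/-- `p` is the weighted `h^*`-polynomial of `P`:
`p = (1 - t) ^ (dim P) * ∑_{lam ∈ ℚ≥0} #(∂_{≠ 0}(lam P) ∩ L) t ^ lam`. -/
def IsWeightedHStar {E : Type*} [NormedAddCommGroup E] [NormedSpace ℝ E] (L : Submodule ℤ E)
    (P : Set E) (p : FracPoly) : Prop :=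
  ∀ lam : ℚ≥0, p.coeff lam =
    FracPoly.mulSeries ((1 - AddMonoidAlgebra.single (1 : ℚ≥0) (1 : ℤ)) ^ polyDim P)
      (fun mu => (latticeCount L (awayBoundary P mu) : ℤ)) lam

open Classical in
/-- The weighted `h^*`-polynomial of `P`, the unique fractional polynomial with
`IsWeightedHStar L P` (and `0` if there were none). -/
def weightedHStar {E : Type*} [NormedAddCommGroup E] [NormedSpace ℝ E] (L : Submodule ℤ E)
    (P : Set E) : FracPoly :=
  if h : ∃ p, IsWeightedHStar L P p then h.choose else 0

/-- The dual polyhedron `P^∨ = {u | ⟨u, v⟩ ≥ -1 for all v ∈ P}`. -/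
def dualPolyhedron {E : Type*} [AddCommGroup E] [Module ℝ E] (P : Set E) :
    Set (Module.Dual ℝ E) :=
  {u | ∀ v ∈ P, -1 ≤ u v}

/-- The dual lattice `Hom(L, ℤ)`: the functionals that take integer values on `L`. -/
def dualLattice {E : Type*} [AddCommGroup E] [Module ℝ E] (L : Submodule ℤ E) :
    Set (Module.Dual ℝ E) :=
  {u | ∀ v ∈ L, ∃ k : ℤ, u v = k}

/-- The positive integers `r` such that `r P^∨` is a lattice polyhedron, i.e. has all its vertices
in the dual lattice. (For a full-dimensional `P` the rational polyhedron `P^∨` contains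
no line, so it is the sum of the convex hull of its vertices and of a rational cone.) -/
def dualDenominators {E : Type*} [AddCommGroup E] [Module ℝ E] (L : Submodule ℤ E) (P : Set E) :
    Set ℕ :=
  {r | 0 < r ∧ ((r : ℝ) • dualPolyhedron P).extremePoints ℝ ⊆ dualLattice L}

/-- The number `r_P`: the least `r > 0` such that `r P^∨` is a lattice polyhedron. -/
def dualIndex {E : Type*} [AddCommGroup E] [Module ℝ E] (L : Submodule ℤ E) (P : Set E) : ℕ :=
  sInf (dualDenominators L P)

/-- The lattice `L ⊕ ⋯ ⊕ L` (`n` summands). -/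
def latticePower {E : Type*} [AddCommGroup E] (L : Submodule ℤ E) (n : ℕ) :
    Submodule ℤ (Fin n → E) :=
  Submodule.pi Set.univ fun _ => L

/-- The free sum `P^{⊕ n}` for `n > 0`: the convex hull of the union of the `n` copies of `P`
in the coordinate subspaces `0 × ⋯ × E × ⋯ × 0`. -/
def freeSumPower {E : Type*} [AddCommGroup E] [Module ℝ E] (P : Set E) (n : ℕ) :
    Set (Fin n → E) :=
  convexHull ℝ (⋃ i : Fin n, (fun v : E => (Pi.single i v : Fin n → E)) '' P)

/-- `h^*(P^{⊕ n}; t)`, taken with respect to the lattice `L ⊕ ⋯ ⊕ L`. -/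
def hStarPower {E : Type*} [AddCommGroup E] [Module ℝ E] (L : Submodule ℤ E) (P : Set E) (n : ℕ) :
    Polynomial ℤ :=
  hStar (latticePower L n) (freeSumPower P n)

/-- `h^*(P^{⊕ n}; x)` for a real number `x`. -/
def hStarPowerEval {E : Type*} [AddCommGroup E] [Module ℝ E] (L : Submodule ℤ E) (P : Set E)
    (n : ℕ) (x : ℝ) : ℝ :=
  Polynomial.aeval x (hStarPower L P n)

end FreeSum

end

open scoped Pointwise Topology NNRat

/-! Everything is a count of lattice points by the gauge g(v) = min {λ ≥ 0 : v ∈ λP}, defined on the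
cone over P. Write P = conv S with S a finite set of lattice points. A regular triangulation, made
half-open by looking from a generic point, splits the cone into disjoint simplicial cones spanned by
points of S, on each of which g is linear (`exists_halfOpen_triangulation`). Reducing coordinates
modulo the generators of each cone then parametrises its lattice points bijectively by finitely many
copies of ℕ^d, d = dim P, with g = e_i + n_1 + ... + n_d on the i-th copy (`exists_isConeParam`).
The linear form of g on a simplex is minus a vertex of P^∨, so r e_i is an integer whenever rP^∨ is
a lattice polyhedron.

Both polynomials can now be read off. The points of ∂_{≠0}(λP) are those of gauge exactly λ
(`mem_awayBoundary_iff`), so h̃ = ∑_i t^{e_i}. The gauge of P^{⊕n} is the sum of the gauges of the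
components (`mem_smul_freeSumPower_iff`), and only integer dilates are counted, so h^*(P^{⊕n}) is
the sum of t^⌈e_{p_1} + ... + e_{p_n}⌉ over all p: it is h̃^n with every exponent rounded up
(`IsConeParam.hStarPower_eq_ceilPoly`).

Rounding up an element of (1/r)ℕ adds at most 1 - 1/r, which gives the two-sided bounds term by
term. Their constants do not depend on n and disappear under n-th roots, which gives the limit.
Hence h̃ determines all h^*(P^{⊕n}) by rounding, and they determine the values of h̃ on x > 0, hence
h̃, by independence of characters. An unordered set of the polynomials suffices because the value of
the n-th one at 1 is k^n, where k is the number of the e_i.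

For the counts: h̃ and d determine every #(λP ∩ N). Conversely, d is visible as a pole order at t =
1, and the number of points of gauge λ is the jump of the counting function at λ. -/

namespace FreeSum

/-! ### Simplicial charts and generic perturbations -/

section Chart

variable {ι E : Type*} [Fintype ι] [DecidableEq ι] [AddCommGroup E] [Module ℝ E] {a : ι → E}

/-- `f` gives the coordinates with respect to the basis formed by the vectors `a i`, `i ∈ T`. -/
structure Chart (a : ι → E) (T : Finset ι) (f : E →ₗ[ℝ] ι → ℝ) : Prop where
  support : ∀ v, ∀ i ∉ T, f v i = 0
  total : ∀ v, ∑ i, f v i • a i = v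
  self : ∀ i ∈ T, f (a i) = Pi.single i 1

theorem Chart.apply_sum {T : Finset ι} {f : E →ₗ[ℝ] ι → ℝ} (h : Chart a T f) {μ : ι → ℝ}
    (hμ : ∀ i ∉ T, μ i = 0) : f (∑ i, μ i • a i) = μ := by
  have : ∀ i, μ i • f (a i) = Pi.single i (μ i) := by
    intro i
    by_cases hi : i ∈ T
    · rw [h.self i hi, ← Pi.single_smul]; simp
    · simp [hμ i hi]
  rw [map_sum]
  simp_rw [map_smul, this]
  exact Finset.univ_sum_single μ

theorem Chart.unique {T : Finset ι} {f g : E →ₗ[ℝ] ι → ℝ} (hf : Chart a T f) (hg : Chart a T g) :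
    f = g := by
  ext1 v
  conv_lhs => rw [← hg.total v]
  exact hf.apply_sum (hg.support v)

/-- A property of charts holds eventually for all charts if it does so for each of them. -/
theorem eventually_forall_chart {α : Type*} {l : Filter α}
    {p : α → Finset ι → (E →ₗ[ℝ] ι → ℝ) → Prop}
    (h : ∀ T f, Chart a T f → ∀ᶠ x in l, p x T f) :
    ∀ᶠ x in l, ∀ T f, Chart a T f → p x T f := by
  rw [Filter.eventually_all]
  intro T
  by_cases hT : ∃ f, Chart a T f
  · obtain ⟨f, hf⟩ := hT
    filter_upwards [h T f hf] with x hx g hg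
    rwa [hg.unique hf]
  · push Not at hT
    exact Filter.Eventually.of_forall fun x f hf => (hT f hf).elim

/-- Basis extension inside U. The coordinates are extended by zero to all of ι, so that charts with
different T share one target space. -/
theorem exists_chart {R U : Set ι} (hRU : R ⊆ U) (hU : Submodule.span ℝ (a '' U) = ⊤)
    (hR : LinearIndepOn ℝ a R) :
    ∃ (T : Finset ι) (f : E →ₗ[ℝ] ι → ℝ), Chart a T f ∧ R ⊆ T ∧ (T : Set ι) ⊆ U := by
  classical
  obtain ⟨t, htU, hRt, hspan, hli⟩ := exists_linearIndepOn_extension hR hRU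
  have htop : ⊤ ≤ Submodule.span ℝ (Set.range fun i : t => a i) := by
    rw [← hU, Submodule.span_le]
    convert hspan using 2
    rw [Set.image_eq_range]
  let b := Module.Basis.mk hli htop
  have hb : ∀ i : t, b i = a i := fun i => congrFun (Module.Basis.coe_mk hli htop) i
  let f : E →ₗ[ℝ] ι → ℝ := LinearMap.pi fun i =>
    if hi : i ∈ t then b.coord ⟨i, hi⟩ else 0
  have hf : ∀ v i, f v i = if hi : i ∈ t then b.repr v ⟨i, hi⟩ else 0 := by
    intro v i
    by_cases hi : i ∈ t <;> simp [f, hi]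
  refine ⟨t.toFinset, f, ⟨?_, ?_, ?_⟩, by simpa using hRt, by simpa using htU⟩
  · intro v i hi
    rw [hf, dif_neg (by simpa using hi)]
  · intro v
    conv_rhs => rw [← b.sum_repr v]
    rw [← Finset.sum_subset (Finset.subset_univ t.toFinset)]
    · rw [← Finset.sum_coe_sort t.toFinset]
      refine Fintype.sum_equiv (Equiv.subtypeEquivRight (by simp)) _ _ ?_
      rintro ⟨i, hi⟩
      have hi' : i ∈ t := by simpa using hi
      rw [hf, dif_pos hi', hb]
      rfl
    · intro i _ hi
      rw [hf, dif_neg (by simpa using hi), zero_smul]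
  · intro i hi
    have hi' : i ∈ t := by simpa using hi
    ext j
    rw [hf]
    have : a i = b ⟨i, hi'⟩ := (hb ⟨i, hi'⟩).symm
    rw [this, b.repr_self]
    by_cases hj : j ∈ t
    · simp [hj, Finsupp.single_apply, Pi.single_apply, eq_comm]
    · rw [dif_neg hj, Pi.single_apply, if_neg]
      rintro rfl; exact hj hi'

/-- A generalised polynomial with distinct positive exponents does not vanish near `0`. -/
theorem eventually_add_sum_pow_ne_zero (r₀ : ℝ) {r : ι → ℝ} {k : ι → ℕ}
    (hk : Function.Injective k) (hk0 : ∀ i, k i ≠ 0) {t : ι} (ht : r t ≠ 0) :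
    ∀ᶠ ε in 𝓝[>] (0 : ℝ), r₀ + ∑ i, r i * ε ^ k i ≠ 0 := by
  let p : Polynomial ℝ :=
    Polynomial.C r₀ + ∑ i, Polynomial.C (r i) * Polynomial.X ^ k i
  have hp : p ≠ 0 := by
    intro h
    have : p.coeff (k t) = r t := by
      simp only [p, Polynomial.coeff_add, Polynomial.finsetSum_coeff, Polynomial.coeff_C_mul,
        Polynomial.coeff_X_pow, Polynomial.coeff_C, if_neg (hk0 t), hk.eq_iff]
      simp
    rw [h] at this
    exact ht (by simpa using this.symm)
  have hfin : {x : ℝ | p.IsRoot x}.Finite := Polynomial.finite_setOfPred_isRoot hp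
  have h1 : ∀ᶠ ε in 𝓝[≠] (0 : ℝ), ε ∉ {x : ℝ | p.IsRoot x} := by
    have h2 : ({x : ℝ | p.IsRoot x} \ {0})ᶜ ∈ 𝓝 (0 : ℝ) :=
      (hfin.subset Set.sdiff_subset).isClosed.isOpen_compl.mem_nhds (by simp)
    rw [eventually_nhdsWithin_iff]
    filter_upwards [h2] with x hx hx0 hx1
    exact hx ⟨hx1, hx0⟩
  have h3 : ∀ᶠ ε in 𝓝[>] (0 : ℝ), ε ∉ {x : ℝ | p.IsRoot x} :=
    h1.filter_mono (nhdsWithin_mono _ fun x hx => ne_of_gt hx)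
  filter_upwards [h3] with ε hε h
  apply hε
  simpa [p, Polynomial.IsRoot, Polynomial.eval_finsetSum] using h

/-- Costs in general position, close to the constant cost `1`. -/
theorem exists_generic_cost (a : ι → E) : ∃ c : ι → ℝ, (∀ i, 0 < c i) ∧
    ∀ T f, Chart a T f → (∀ s ∉ T, ∑ i, c i * f (a s) i ≠ c s) ∧
      ((∀ s, ∑ i, c i * f (a s) i ≤ c s) → ∀ s, ∑ i, f (a s) i ≤ 1) := by
  -- The costs are 1 + ε^(k i) with distinct positive exponents. For s ∉ T the reduced cost is then
  -- a polynomial in ε whose coefficient at ε^(k s) is -1 up to sign, so it is nonzero for small ε.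
  -- A strict violation of feasibility at cost 1 also survives a small perturbation, which gives the
  -- second property.
  let k : ι → ℕ := fun i => Fintype.equivFin ι i + 1
  have hk : Function.Injective k := fun i j h => 
    (Fintype.equivFin ι).injective (Fin.ext (by simpa [k] using h))
  have hk0 : ∀ i, k i ≠ 0 := fun i => by simp [k]
  have key : ∀ᶠ ε in 𝓝[>] (0 : ℝ), ∀ T f, Chart a T f →
      (∀ s ∉ T, ∑ i, (1 + ε ^ k i) * f (a s) i ≠ 1 + ε ^ k s) ∧
      ((∀ s, ∑ i, (1 + ε ^ k i) * f (a s) i ≤ 1 + ε ^ k s) → ∀ s, ∑ i, f (a s) i ≤ 1) := by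
    apply eventually_forall_chart
    intro T f hf
    apply Filter.Eventually.and
    · rw [Filter.eventually_all]
      intro s
      by_cases hs : s ∈ T
      · simp [hs]
      filter_upwards [eventually_add_sum_pow_ne_zero (∑ i, f (a s) i - 1)
        (r := f (a s) - Pi.single s 1) hk hk0 (t := s) (by simp [hf.support _ _ hs])] with ε hε _ h
      apply hε
      simp only [Pi.sub_apply, sub_mul, Finset.sum_sub_distrib]
      simp only [add_mul, one_mul, Finset.sum_add_distrib] at h
      simp only [Pi.single_apply, ite_mul, one_mul, zero_mul, Finset.sum_ite_eq',
        Finset.mem_univ, if_true]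
      simp only [mul_comm (f (a s) _)]
      linarith
    · have : ∀ s, 1 < ∑ i, f (a s) i →
          ∀ᶠ ε in 𝓝[>] (0 : ℝ), 1 + ε ^ k s < ∑ i, (1 + ε ^ k i) * f (a s) i := by
        intro s hs
        have h0 : ∀ᶠ ε in 𝓝 (0 : ℝ), 1 + ε ^ k s < ∑ i, (1 + ε ^ k i) * f (a s) i := by
          apply ContinuousAt.eventually_lt
          · fun_prop
          · fun_prop
          · simpa [hk0] using hs
        exact h0.filter_mono nhdsWithin_le_nhds
      have h2 : ∀ᶠ ε in 𝓝[>] (0 : ℝ), ∀ s, 1 < ∑ i, f (a s) i →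
          1 + ε ^ k s < ∑ i, (1 + ε ^ k i) * f (a s) i := by
        rw [Filter.eventually_all]
        intro s
        by_cases hs : 1 < ∑ i, f (a s) i
        · simpa [hs] using this s hs
        · simp [hs]
      filter_upwards [h2] with ε hε h s
      by_contra hs
      exact absurd (hε s (not_le.mp hs)) (not_lt.mpr (h s))
  obtain ⟨ε, hε, hpos⟩ := (key.and self_mem_nhdsWithin).exists
  have hpos : 0 < ε := hpos
  exact ⟨fun i => 1 + ε ^ k i, fun i => by positivity, hε⟩

/-- A positive combination of the vectors, none of whose coordinates vanishes in any chart. -/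
theorem exists_generic_vector (a : ι → E) : ∃ κ : ι → ℝ, (∀ i, 0 < κ i) ∧
    ∀ T f, Chart a T f → ∀ i ∈ T, f (∑ s, κ s • a s) i ≠ 0 := by
  let k : ι → ℕ := fun i => Fintype.equivFin ι i + 1
  have hk : Function.Injective k := fun i j h => 
    (Fintype.equivFin ι).injective (Fin.ext (by simpa [k] using h))
  have hk0 : ∀ i, k i ≠ 0 := fun i => by simp [k]
  have key : ∀ᶠ ε in 𝓝[>] (0 : ℝ), ∀ T f, Chart a T f →
      ∀ i ∈ T, f (∑ s, ε ^ k s • a s) i ≠ 0 := by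
    apply eventually_forall_chart
    intro T f hf
    rw [Filter.eventually_all]
    intro i
    by_cases hi : i ∈ T
    · filter_upwards [eventually_add_sum_pow_ne_zero 0 (r := fun s => f (a s) i) hk hk0 (t := i)
        (by simp [hf.self i hi])] with ε hε _ h
      apply hε
      rw [zero_add, ← h]
      simp [Finset.sum_apply, mul_comm]
    · simp [hi]
  obtain ⟨ε, hε, hpos⟩ := (key.and self_mem_nhdsWithin).exists
  have hpos : 0 < ε := hpos
  exact ⟨fun i => ε ^ k i, fun i => by positivity, hε⟩

end Chart

/-! ### Linear programming and the half-open triangulation -/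

/-- The cost of a vector in a chart whose cost functional is dual feasible is minimal. -/
theorem cost_apply_sum_le {ι E : Type*} [Fintype ι] [AddCommGroup E] [Module ℝ E] {a : ι → E}
    {f : E →ₗ[ℝ] ι → ℝ} {c : ι → ℝ}
    (hc : ∀ s, ∑ i, c i * f (a s) i ≤ c s) {μ : ι → ℝ} (hμ : ∀ i, 0 ≤ μ i) :
    ∑ i, c i * f (∑ s, μ s • a s) i ≤ ∑ s, μ s * c s := by
  have : ∑ i, c i * f (∑ s, μ s • a s) i = ∑ s, μ s * ∑ i, c i * f (a s) i := by
    simp only [map_sum, map_smul, Finset.sum_apply, Pi.smul_apply, smul_eq_mul, Finset.mul_sum]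
    rw [Finset.sum_comm]
    refine Finset.sum_congr rfl fun s _ => Finset.sum_congr rfl fun i _ => by ring
  rw [this]
  exact Finset.sum_le_sum fun s _ => mul_le_mul_of_nonneg_left (hc s) (hμ s)

/-- Positive costs bound each coordinate by the total cost, so the feasible set below the cost of μ
is compact. -/
theorem exists_min_cost {ι E : Type*} [Fintype ι] [NormedAddCommGroup E] [NormedSpace ℝ E]
    (a : ι → E) {c : ι → ℝ} (hc : ∀ i, 0 < c i) {μ : ι → ℝ} (hμ : ∀ i, 0 ≤ μ i) :
    ∃ l : ι → ℝ, (∀ i, 0 ≤ l i) ∧ ∑ i, l i • a i = ∑ i, μ i • a i ∧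
      ∀ l' : ι → ℝ, (∀ i, 0 ≤ l' i) → ∑ i, l' i • a i = ∑ i, μ i • a i →
        ∑ i, c i * l i ≤ ∑ i, c i * l' i := by
  let K : Set (ι → ℝ) := {l | (∀ i, 0 ≤ l i) ∧ ∑ i, l i • a i = ∑ i, μ i • a i ∧
    ∑ i, c i * l i ≤ ∑ i, c i * μ i}
  have hK : IsCompact K := by
    refine (isCompact_Icc (a := 0) (b := fun i => (∑ i, c i * μ i) / c i)).of_isClosed_subset
      ?_ ?_
    · simp only [K, Set.ofPred_and, Set.ofPred_forall]
      refine (isClosed_iInter fun i => isClosed_le (by fun_prop) (by fun_prop)).inter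
        ((isClosed_eq (by fun_prop) (by fun_prop)).inter
          (isClosed_le (by fun_prop) (by fun_prop)))
    · rintro l ⟨h0, -, h⟩
      refine ⟨h0, fun i => ?_⟩
      rw [le_div_iff₀ (hc i), mul_comm]
      exact (Finset.single_le_sum (f := fun i => c i * l i)
        (fun j _ => mul_nonneg (hc j).le (h0 j)) (Finset.mem_univ i)).trans h
  obtain ⟨l, hl, hmin⟩ := hK.exists_isMinOn ⟨μ, hμ, rfl, le_rfl⟩
    (f := fun l : ι → ℝ => ∑ i, c i * l i) (by fun_prop)
  refine ⟨l, hl.1, hl.2.1, fun l' h0 h1 => ?_⟩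
  by_cases h : ∑ i, c i * l' i ≤ ∑ i, c i * μ i
  · exact hmin ⟨h0, h1, h⟩
  · exact hl.2.2.trans (not_le.mp h).le

/-- First order optimality condition. -/
theorem cost_nonneg_of_min {ι E : Type*} [Fintype ι] [AddCommGroup E] [Module ℝ E]
    {a : ι → E} {c l : ι → ℝ} {x : E} (h0 : ∀ i, 0 ≤ l i) (hx : ∑ i, l i • a i = x)
    (hmin : ∀ l' : ι → ℝ, (∀ i, 0 ≤ l' i) → ∑ i, l' i • a i = x →
        ∑ i, c i * l i ≤ ∑ i, c i * l' i)
    {μ : ι → ℝ} (hμ : ∑ i, μ i • a i = 0) (hμ0 : ∀ i, l i = 0 → 0 ≤ μ i) :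
    0 ≤ ∑ i, c i * μ i := by
  have key : ∀ᶠ δ in 𝓝[>] (0 : ℝ), ∀ i, 0 ≤ l i + δ * μ i := by
    rw [Filter.eventually_all]
    intro i
    rcases (h0 i).eq_or_lt with h | h
    · filter_upwards [self_mem_nhdsWithin] with δ hδ
      have hδ : 0 < δ := hδ
      have := hμ0 i h.symm
      rw [← h]; positivity
    · have : ∀ᶠ δ in 𝓝 (0 : ℝ), 0 < l i + δ * μ i := by
        apply ContinuousAt.eventually_lt (by fun_prop) (by fun_prop)
        simpa using h
      filter_upwards [this.filter_mono nhdsWithin_le_nhds] with δ hδ using hδ.le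
  obtain ⟨δ, hδ, hpos⟩ := (key.and self_mem_nhdsWithin).exists
  have hpos : 0 < δ := hpos
  have := hmin (fun i => l i + δ * μ i) hδ (by
    simp only [add_smul, mul_smul, Finset.sum_add_distrib, ← Finset.smul_sum, hμ, hx]
    simp)
  simp only [mul_add, Finset.sum_add_distrib] at this
  have h2 : ∑ i, c i * (δ * μ i) = δ * ∑ i, c i * μ i := by
    rw [Finset.mul_sum]; exact Finset.sum_congr rfl fun i _ => by ring
  rw [h2] at this
  exact nonneg_of_mul_nonneg_right (by linarith) hpos

/-- An optimal basis for the linear program that writes a generic vector as a nonnegative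
combination of least cost. The dual feasible charts are the maximal cones of the regular
triangulation induced by c, so this says that they cover all generic vectors. -/
theorem exists_optimal_chart {ι E : Type*} [Fintype ι] [DecidableEq ι] [NormedAddCommGroup E]
    [NormedSpace ℝ E] {a : ι → E} (hspan : Submodule.span ℝ (Set.range a) = ⊤)
    {c : ι → ℝ} (hc : ∀ i, 0 < c i)
    (hgen : ∀ T f, Chart a T f → ∀ s ∉ T, ∑ i, c i * f (a s) i ≠ c s)
    {μ : ι → ℝ} (hμ : ∀ i, 0 ≤ μ i)
    (hx : ∀ T f, Chart a T f → ∀ i ∈ T, f (∑ s, μ s • a s) i ≠ 0) :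
    ∃ T f, Chart a T f ∧ (∀ s, ∑ i, c i * f (a s) i ≤ c s) ∧
      ∀ i, 0 ≤ f (∑ s, μ s • a s) i := by
  obtain ⟨l, h0, hl, hmin⟩ := exists_min_cost a hc hμ
  set x := ∑ s, μ s • a s
  let U : Set ι := {i | l i ≠ 0}
  -- A basis R chosen within the support U extends to a chart T of the whole space. The vector x has
  -- no coordinates in T outside R, so genericity of x forces T ⊆ R.
  have hU : Submodule.span ℝ (a '' U) = ⊤ := by
    obtain ⟨R, hRU, -, hUR, hR⟩ := exists_linearIndepOn_extension
      (linearIndepOn_empty ℝ a) (Set.empty_subset U)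
    obtain ⟨T, f, hf, hRT, -⟩ := exists_chart (Set.subset_univ R)
      (by rwa [Set.image_univ]) hR
    have hxR : x ∈ Submodule.span ℝ (a '' R) := by
      rw [← hl]
      refine Submodule.sum_mem _ fun i _ => ?_
      by_cases hi : l i = 0
      · simp [hi]
      · exact Submodule.smul_mem _ _ (hUR ⟨i, hi, rfl⟩)
    have hzero : ∀ y ∈ Submodule.span ℝ (a '' R), ∀ i ∉ R, f y i = 0 := by
      intro y hy i hi
      induction hy using Submodule.span_induction with
      | mem v hv =>
        obtain ⟨j, hj, rfl⟩ := hv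
        rw [hf.self j (hRT hj), Pi.single_apply, if_neg]
        rintro rfl; exact hi hj
      | zero => simp
      | add v w _ _ hv hw => simp [hv, hw]
      | smul r v _ hv => simp [hv]
    have hTR : ∀ i ∈ T, i ∈ R := fun i hi => by
      by_contra h
      exact hx T f hf i hi (hzero x hxR i h)
    rw [eq_top_iff]
    rintro v -
    rw [← hf.total v]
    refine Submodule.sum_mem _ fun i _ => ?_
    by_cases hi : i ∈ T
    · exact Submodule.smul_mem _ _ (Submodule.subset_span ⟨i, hRU (hTR i hi), rfl⟩)
    · simp [hf.support v i hi]
  obtain ⟨T, f, hf, -, hTU⟩ := exists_chart (Set.empty_subset U) hU (linearIndepOn_empty ℝ a)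
  have hdir : ∀ s, ∑ i, ((Pi.single s 1 - f (a s) : ι → ℝ) i) • a i = 0 := by
    intro s
    simp [sub_smul, Finset.sum_sub_distrib, hf.total, Pi.single_apply]
  have hcost : ∀ s, ∑ i, c i * (Pi.single s 1 - f (a s) : ι → ℝ) i
      = c s - ∑ i, c i * f (a s) i := by
    intro s
    simp [mul_sub, Finset.sum_sub_distrib, Pi.single_apply]
  -- Bringing in a s and compensating along T is an admissible direction, since l is nonzero on T.
  -- Its derivative of cost is the reduced cost of s.
  have hfeas : ∀ s, ∑ i, c i * f (a s) i ≤ c s := by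
    intro s
    have := cost_nonneg_of_min h0 hl hmin (hdir s) (fun i hi => by
      have : i ∉ T := fun h => hTU h hi
      simp only [Pi.sub_apply, hf.support _ i this, sub_zero, Pi.single_apply]
      split_ifs <;> norm_num)
    rw [hcost] at this
    linarith
  refine ⟨T, f, hf, hfeas, ?_⟩
  -- If l s ≠ 0 the opposite direction is admissible too, so the reduced cost of s vanishes, against
  -- genericity of c.
  have hsupp : ∀ s ∉ T, l s = 0 := by
    intro s hs
    by_contra hls
    have := cost_nonneg_of_min h0 hl hmin (μ := -(Pi.single s 1 - f (a s) : ι → ℝ))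
      (by simpa only [Pi.neg_apply, neg_smul, Finset.sum_neg_distrib, neg_eq_zero] using hdir s)
      (fun i hi => by
        have h1 : i ∉ T := fun h => hTU h hi
        have h2 : i ≠ s := by rintro rfl; exact hls hi
        simp [hf.support _ i h1, h2])
    simp only [Pi.neg_apply, mul_neg, Finset.sum_neg_distrib] at this
    rw [hcost] at this
    exact hgen T f hf s hs (le_antisymm (hfeas s) (by linarith))
  intro i
  rw [← hl, hf.apply_sum hsupp]
  exact h0 i

/-- The half-open cone of a chart: the facets that are visible from the generic point `w`
are removed. -/
def InCell {ι E : Type*} [AddCommGroup E] [Module ℝ E] (w : E) (T : Finset ι)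
    (f : E →ₗ[ℝ] ι → ℝ) (v : E) : Prop :=
  ∀ i ∈ T, 0 ≤ f v i ∧ (f w i < 0 → 0 < f v i)

/-- The cone over a polytope is the disjoint union of finitely many half-open simplicial cones
spanned by points on the boundary, over which the polytope is a simplex. -/
theorem exists_halfOpen_triangulation {ι E : Type*} [Fintype ι] [DecidableEq ι]
    [NormedAddCommGroup E] [NormedSpace ℝ E] {a : ι → E}
    (hspan : Submodule.span ℝ (Set.range a) = ⊤) :
    ∃ (w : E) (G : Finset ι → (E →ₗ[ℝ] ι → ℝ) → Prop),
      (∀ T f, G T f → Chart a T f ∧ ∀ s, ∑ i, f (a s) i ≤ 1) ∧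
      (∀ μ : ι → ℝ, (∀ i, 0 ≤ μ i) → ∃ T f, G T f ∧ InCell w T f (∑ i, μ i • a i)) ∧
      (∀ T f T' f' v, G T f → G T' f' → InCell w T f v → InCell w T' f' v → T = T') := by
  obtain ⟨c, hc, hgen⟩ := exists_generic_cost a
  obtain ⟨κ, hκ, hw⟩ := exists_generic_vector a
  set w := ∑ s, κ s • a s with hwdef
  -- Membership of v in a half-open cell means that v + ηw lies in the open cone for small η > 0.
  -- This reduces covering and disjointness to generic points.
  have near : ∀ v, ∀ᶠ η in 𝓝[>] (0 : ℝ), ∀ T f, Chart a T f → ∀ i, i ∈ T →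
      f (v + η • w) i ≠ 0 ∧
      (0 < f (v + η • w) i ↔ 0 ≤ f v i ∧ (f w i < 0 → 0 < f v i)) := by
    intro v
    apply eventually_forall_chart
    intro T f hf
    rw [Filter.eventually_all]
    intro i
    by_cases hi : i ∈ T
    swap; · simp [hi]
    have hlin : ∀ η : ℝ, f (v + η • w) i = f v i + η * f w i := fun η => by simp
    simp only [hlin]
    have hwi := hw T f hf i hi
    rcases lt_trichotomy (f v i) 0 with h | h | h
    · have : ∀ᶠ η in 𝓝 (0 : ℝ), f v i + η * f w i < 0 := by
        apply ContinuousAt.eventually_lt (by fun_prop) (by fun_prop)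
        simpa using h
      filter_upwards [this.filter_mono nhdsWithin_le_nhds] with η hη _
      exact ⟨hη.ne, iff_of_false (not_lt.mpr hη.le) fun h' => absurd h'.1 (not_le.mpr h)⟩
    · filter_upwards [self_mem_nhdsWithin] with η hη _
      have hη : 0 < η := hη
      rw [h, zero_add]
      refine ⟨mul_ne_zero hη.ne' hwi, ?_⟩
      rw [mul_pos_iff_of_pos_left hη]
      constructor
      · intro h1; exact ⟨le_rfl, fun h2 => absurd h1 h2.not_gt⟩
      · rintro ⟨-, h2⟩
        exact lt_of_le_of_ne (not_lt.mp fun h3 => lt_irrefl _ (h2 h3)) hwi.symm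
    · have : ∀ᶠ η in 𝓝 (0 : ℝ), 0 < f v i + η * f w i := by
        apply ContinuousAt.eventually_lt (by fun_prop) (by fun_prop)
        simpa using h
      filter_upwards [this.filter_mono nhdsWithin_le_nhds] with η hη _
      exact ⟨hη.ne', iff_of_true hη ⟨h.le, fun _ => h⟩⟩
  refine ⟨w, fun T f => Chart a T f ∧ ∀ s, ∑ i, c i * f (a s) i ≤ c s,
    fun T f h => ⟨h.1, (hgen T f h.1).2 h.2⟩, ?_, ?_⟩
  · intro μ hμ
    obtain ⟨η, hη, hpos⟩ := ((near (∑ i, μ i • a i)).and self_mem_nhdsWithin).exists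
    have hpos : 0 < η := hpos
    have hsum : ∑ i, (μ i + η * κ i) • a i = ∑ i, μ i • a i + η • w := by
      simp [add_smul, mul_smul, Finset.sum_add_distrib, Finset.smul_sum, hwdef]
    obtain ⟨T, f, hf, hfe, hx⟩ := exists_optimal_chart hspan hc (fun T f hf => (hgen T f hf).1)
      (μ := fun i => μ i + η * κ i)
      (fun i => add_nonneg (hμ i) (mul_nonneg hpos.le (hκ i).le))
      (by rw [hsum]; exact fun T f hf i hi => (hη T f hf i hi).1)
    rw [hsum] at hx
    exact ⟨T, f, ⟨hf, hfe⟩, fun i hi => (hη T f hf i hi).2.1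
      (lt_of_le_of_ne (hx i) (hη T f hf i hi).1.symm)⟩
  · have key : ∀ T f T' f' v, Chart a T f → (∀ s, ∑ i, c i * f (a s) i ≤ c s) → Chart a T' f' →
        (∀ s, ∑ i, c i * f' (a s) i ≤ c s) → InCell w T f v → InCell w T' f' v → T' ⊆ T := by
      intro T f T' f' v hf hfe hf' hfe' hv hv'
      obtain ⟨η, hη, hpos⟩ := ((near v).and self_mem_nhdsWithin).exists
      set x := v + η • w
      have h1 : ∀ i ∈ T, 0 < f x i := fun i hi => (hη T f hf i hi).2.2 (hv i hi)
      have h1' : ∀ i ∈ T', 0 < f' x i := fun i hi => (hη T' f' hf' i hi).2.2 (hv' i hi)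
      have n1 : ∀ i, 0 ≤ f x i := fun i => by
        by_cases hi : i ∈ T
        · exact (h1 i hi).le
        · rw [hf.support x i hi]
      have n1' : ∀ i, 0 ≤ f' x i := fun i => by
        by_cases hi : i ∈ T'
        · exact (h1' i hi).le
        · rw [hf'.support x i hi]
      -- The chart `f'` gives x its least cost. An index s in T' but not in T would have strictly
      -- positive reduced cost in `f`, making the cost in `f` strictly smaller than that in `f'`.
      have e1 : ∑ i, c i * f' x i ≤ ∑ i, c i * f x i := by
        have := cost_apply_sum_le hfe' n1
        rw [hf.total] at this
        simpa only [mul_comm] using this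
      have e2 : ∑ i, c i * f x i = ∑ s, f' x s * ∑ i, c i * f (a s) i := by
        conv_lhs => rw [← hf'.total x]
        simp only [map_sum, map_smul, Finset.sum_apply, Pi.smul_apply, smul_eq_mul,
          Finset.mul_sum]
        rw [Finset.sum_comm]
        refine Finset.sum_congr rfl fun s _ => Finset.sum_congr rfl fun i _ => by ring
      intro s hs
      by_contra hsT
      have hlt := lt_of_le_of_ne (hfe s) ((hgen T f hf).1 s hsT)
      have : ∑ s, f' x s * ∑ i, c i * f (a s) i < ∑ s, f' x s * c s :=
        Finset.sum_lt_sum (fun i _ => mul_le_mul_of_nonneg_left (hfe i) (n1' i))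
          ⟨s, Finset.mem_univ s, mul_lt_mul_of_pos_left hlt (h1' s hs)⟩
      rw [← e2] at this
      simp only [mul_comm] at this e1
      exact absurd e1 (not_le.mpr this)
    intro T f T' f' v h h' hv hv'
    exact (key T' f' T f v h'.1 h'.2 h.1 h.2 hv' hv).antisymm
      (key T f T' f' v h.1 h.2 h'.1 h'.2 hv hv')

/-! ### The gauge of P, its facets away from the origin, and the vertices of the dual -/

/-- Since 0 ∈ P, any weight missing from a convex combination can be put on the origin; hence the
inequality in place of an equality. -/
theorem mem_smul_convexHull_iff {E : Type*} [AddCommGroup E] [Module ℝ E] {S : Finset E}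
    (h0 : (0 : E) ∈ convexHull ℝ (S : Set E)) {lam : ℝ} (hlam : 0 ≤ lam) {v : E} :
    v ∈ lam • convexHull ℝ (S : Set E) ↔
      ∃ μ : S → ℝ, (∀ i, 0 ≤ μ i) ∧ ∑ i, μ i ≤ lam ∧ ∑ i, μ i • (i : E) = v := by
  constructor
  · rintro ⟨p, hp, rfl⟩
    obtain ⟨w, hw0, hw1, rfl⟩ := Finset.mem_convexHull'.mp hp
    refine ⟨fun i => lam * w i, fun i => mul_nonneg hlam (hw0 i i.2), ?_, ?_⟩
    · rw [Finset.sum_coe_sort S (fun i => lam * w i), ← Finset.mul_sum, hw1, mul_one]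
    · rw [Finset.sum_coe_sort S (fun i => (lam * w i) • i)]
      simp [Finset.smul_sum, mul_smul]
  · rintro ⟨μ, hμ0, hμ1, rfl⟩
    rcases hlam.eq_or_lt with rfl | hpos
    · have : ∀ i, μ i = 0 := fun i => le_antisymm
        ((Finset.single_le_sum (fun j _ => hμ0 j) (Finset.mem_univ i)).trans hμ1) (hμ0 i)
      exact ⟨0, h0, by simp [this]⟩
    · have hconv := convex_convexHull ℝ (S : Set E)
      have hmem : ∑ i, (μ i / lam) • (i : E) ∈ convexHull ℝ (S : Set E) := by
        have := hconv.sum_mem (t := Finset.univ)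
          (w := fun o : Option S => o.elim (1 - ∑ i, μ i / lam) fun i => μ i / lam)
          (z := fun o : Option S => o.elim 0 fun i => (i : E)) ?_ ?_ ?_
        · simpa [Fintype.sum_option] using this
        · rintro (_ | i) _
          · simp only [Option.elim_none, sub_nonneg, ← Finset.sum_div]
            exact div_le_one_of_le₀ hμ1 hpos.le
          · exact div_nonneg (hμ0 i) hpos.le
        · simp [Fintype.sum_option]
        · rintro (_ | i) _
          · exact h0
          · exact subset_convexHull ℝ _ i.2
      refine ⟨_, hmem, ?_⟩
      simp only [Finset.smul_sum, smul_smul]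
      exact Finset.sum_congr rfl fun i _ => by rw [mul_div_cancel₀ _ hpos.ne']

theorem polyDim_eq_finrank {E : Type*} [AddCommGroup E] [Module ℝ E] {Q : Set E}
    (h0 : (0 : E) ∈ Q) (hQ : Submodule.span ℝ Q = ⊤) : polyDim Q = Module.finrank ℝ E := by
  have h : vectorSpan ℝ Q = ⊤ := by
    rw [vectorSpan_eq_span_vsub_set_right ℝ h0]
    simpa using hQ
  rw [polyDim, h, finrank_top]

/-- In the cone over a simplex of the boundary, the gauge is the sum of the coordinates. -/
theorem Chart.mem_smul_iff {E : Type*} [AddCommGroup E] [Module ℝ E] {S : Finset E}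
    (h0 : (0 : E) ∈ convexHull ℝ (S : Set E)) [DecidableEq S] {T : Finset S}
    {f : E →ₗ[ℝ] S → ℝ} (hf : Chart (fun i : S => (i : E)) T f)
    (hle : ∀ s : S, ∑ i, f s i ≤ 1) {v : E} (hv : ∀ i, 0 ≤ f v i) {lam : ℝ} (hlam : 0 ≤ lam) :
    v ∈ lam • convexHull ℝ (S : Set E) ↔ ∑ i, f v i ≤ lam := by
  rw [mem_smul_convexHull_iff h0 hlam]
  constructor
  · rintro ⟨μ, hμ0, hμ1, rfl⟩
    have := cost_apply_sum_le (a := fun i : S => (i : E)) (f := f) (c := 1)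
      (by simpa using hle) hμ0
    simp only [Pi.one_apply, one_mul, mul_one] at this
    exact this.trans hμ1
  · intro h
    exact ⟨f v, hv, h, hf.total v⟩

section Polytope

variable {E : Type*} [NormedAddCommGroup E] [NormedSpace ℝ E] {S : Finset E}

theorem span_coe_eq_top (hS : affineSpan ℝ (convexHull ℝ (S : Set E)) = ⊤) :
    Submodule.span ℝ (Set.range fun i : S => (i : E)) = ⊤ := by
  have hr : Set.range (fun i : S => (i : E)) = (S : Set E) := by simp
  rw [hr, eq_top_iff]
  have h1 : affineSpan ℝ (convexHull ℝ (S : Set E)) ≤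
      (Submodule.span ℝ (S : Set E)).toAffineSubspace := by
    rw [affineSpan_convexHull, affineSpan_le]
    exact Submodule.subset_span
  rw [hS] at h1
  intro v _
  exact h1 (AffineSubspace.mem_top ℝ E v)

theorem span_smul_eq_top
    (hS : affineSpan ℝ (convexHull ℝ (S : Set E)) = ⊤) {lam : ℝ} (hlam : 0 < lam) :
    Submodule.span ℝ (lam • convexHull ℝ (S : Set E)) = ⊤ := by
  rw [eq_top_iff, ← span_coe_eq_top hS, Submodule.span_le]
  rintro _ ⟨i, rfl⟩
  have : (i : E) = lam⁻¹ • (lam • (i : E)) := by rw [inv_smul_smul₀ hlam.ne']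
  dsimp only
  rw [this]
  exact Submodule.smul_mem _ _ (Submodule.subset_span
    (Set.smul_mem_smul_set (subset_convexHull ℝ _ i.2)))

/-- The union of the facets missing the origin is a level set of the gauge. If a point v of such a
face were in μP with μ < λ, comparing v with its multiple in λP would show that the exposing
functional is at most 0 at v, so that the face contains 0. Conversely, the coordinate sum in the
cell of v supports λP along a facet through v. -/
theorem mem_awayBoundary_iff [FiniteDimensional ℝ E] (h0 : (0 : E) ∈ convexHull ℝ (S : Set E))
    (hS : affineSpan ℝ (convexHull ℝ (S : Set E)) = ⊤) {lam : ℚ≥0} {v : E} :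
    v ∈ awayBoundary (convexHull ℝ (S : Set E)) lam ↔
      v ∈ (lam : ℝ) • convexHull ℝ (S : Set E) ∧
        ∀ μ : ℝ, 0 ≤ μ → μ < lam → v ∉ μ • convexHull ℝ (S : Set E) := by
  classical
  set P := convexHull ℝ (S : Set E) with hPdef
  have hzs : (0 : ℝ) • P = {0} := by
    rw [Set.zero_smul_set ⟨0, h0⟩]; rfl
  have hz : ∀ μ : ℝ, (0 : E) ∈ μ • P := fun μ => ⟨0, h0, by simp⟩
  rcases eq_or_ne lam 0 with rfl | hlam
  · simp only [awayBoundary, if_true, NNRat.cast_zero, hzs, iff_self_and]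
    intro _ μ h1 h2
    exact absurd h1 (not_le.mpr h2)
  have hpos : (0 : ℝ) < lam := by
    have : 0 < lam := pos_iff_ne_zero.mpr hlam
    exact_mod_cast this
  simp only [awayBoundary, if_neg hlam]
  constructor
  · rintro ⟨F, hF, hF0, hv⟩
    obtain ⟨l, rfl⟩ := hF.isExposed hF.nonempty
    refine ⟨hv.1, fun μ hμ0 hμ hvμ => hF0 ⟨hz _, fun y hy => ?_⟩⟩
    have hlv : 0 ≤ l v := by simpa using hv.2 0 (hz _)
    obtain ⟨p, hp, rfl⟩ := hvμ
    have h1 := hv.2 ((lam : ℝ) • p) ⟨p, hp, rfl⟩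
    simp only [map_smul, smul_eq_mul] at h1 hlv
    have hp0 : l p ≤ 0 := by
      by_contra h
      push Not at h
      nlinarith
    have : l ((fun x => μ • x) p) ≤ 0 := by
      simp only [map_smul, smul_eq_mul]
      exact mul_nonpos_of_nonneg_of_nonpos hμ0 hp0
    rw [map_zero]
    exact (hv.2 y hy).trans this
  · rintro ⟨hv, hmin⟩
    obtain ⟨w, G, hG, hex, -⟩ := exists_halfOpen_triangulation (span_coe_eq_top hS)
    obtain ⟨μ, hμ0, -, hμ⟩ := (mem_smul_convexHull_iff h0 hpos.le).mp hv
    obtain ⟨T, f, hT, hcell⟩ := hex μ hμ0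
    obtain ⟨hf, hle⟩ := hG T f hT
    rw [hμ] at hcell
    have hnn : ∀ i, 0 ≤ f v i := fun i => by
      by_cases hi : i ∈ T
      · exact (hcell i hi).1
      · rw [hf.support v i hi]
    let u : E →ₗ[ℝ] ℝ := ∑ i, (LinearMap.proj i).comp f
    have hu : ∀ x, u x = ∑ i, f x i := fun x => by simp [u]
    have huT : ∀ i ∈ T, u i = 1 := fun i hi => by simp [hu, hf.self i hi]
    have huv : u v = lam := by
      have h1 := (hf.mem_smul_iff h0 hle hnn hpos.le).mp hv
      have hnn' : 0 ≤ ∑ i, f v i := Finset.sum_nonneg fun i _ => hnn i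
      rw [hu]
      refine h1.antisymm (not_lt.mp fun h2 => hmin _ hnn' h2 ?_)
      rw [hf.mem_smul_iff h0 hle hnn hnn']
    have hule : ∀ x ∈ (lam : ℝ) • P, u x ≤ lam := by
      intro x hx
      obtain ⟨μ, hμ0, hμ1, rfl⟩ := (mem_smul_convexHull_iff h0 hpos.le).mp hx
      rw [hu]
      have := cost_apply_sum_le (a := fun i : S => (i : E)) (f := f) (c := 1)
        (by simpa using hle) hμ0
      simp only [Pi.one_apply, one_mul, mul_one] at this
      exact this.trans hμ1
    set F : Set E := {x | x ∈ (lam : ℝ) • P ∧ u x = lam} with hFdef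
    have hbT : ∀ i ∈ T, (lam : ℝ) • (i : E) ∈ F := fun i hi =>
      ⟨Set.smul_mem_smul_set (subset_convexHull ℝ _ i.2), by simp [huT i hi]⟩
    obtain ⟨i₀, hi₀⟩ : T.Nonempty := by
      by_contra h
      rw [Finset.not_nonempty_iff_eq_empty] at h
      have : u v = 0 := by
        rw [hu]
        exact Finset.sum_eq_zero fun i _ => hf.support v i (by simp [h])
      rw [huv] at this
      exact hpos.ne' this
    refine ⟨F, ⟨⟨v, hv, huv⟩, fun _ => ⟨u.toContinuousLinearMap, ?_⟩, ?_⟩, ?_, hv, huv⟩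
    · ext x
      constructor
      · rintro ⟨hx, hxu⟩
        exact ⟨hx, fun y hy => by simpa [hxu] using hule y hy⟩
      · rintro ⟨hx, hxu⟩
        exact ⟨hx, (hule x hx).antisymm (by simpa [huv] using hxu v hv)⟩
    · rw [polyDim_eq_finrank (hz _) (span_smul_eq_top hS hpos), polyDim]
      have hker : vectorSpan ℝ F = LinearMap.ker u := by
        apply le_antisymm
        · rw [vectorSpan_def, Submodule.span_le]
          rintro _ ⟨x, hx, y, hy, rfl⟩
          simp [hx.2, hy.2]
        · intro x hx
          rw [LinearMap.mem_ker, hu] at hx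
          -- The coordinates of x sum to zero, so subtracting the base vertex changes nothing.
          have hx' : x = ∑ i, (f x i / lam) • ((lam : ℝ) • (i : E) -ᵥ (lam : ℝ) • (i₀ : E)) := by
            simp only [vsub_eq_sub, smul_sub, smul_smul, div_mul_cancel₀ _ hpos.ne',
              Finset.sum_sub_distrib, ← Finset.sum_smul, hx, zero_smul, sub_zero]
            exact (hf.total x).symm
          rw [hx']
          refine Submodule.sum_mem _ fun i _ => ?_
          by_cases hi : i ∈ T
          · exact Submodule.smul_mem _ _ (vsub_mem_vectorSpan ℝ (hbT i hi) (hbT i₀ hi₀))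
          · simp [hf.support x i hi]
      rw [hker]
      apply Module.Dual.finrank_ker_add_one_of_ne_zero
      intro h
      have := huT i₀ hi₀
      rw [h] at this
      simp at this
    · rintro ⟨-, h⟩
      rw [map_zero] at h
      exact hpos.ne h

theorem mem_smul_dualPolyhedron_iff {r : ℝ} (hr : 0 < r) {u : Module.Dual ℝ E} :
    u ∈ r • dualPolyhedron (convexHull ℝ (S : Set E)) ↔ ∀ s : S, -r ≤ u s := by
  rw [Set.mem_smul_set_iff_inv_smul_mem₀ hr.ne']
  have h1 : ∀ v : E, -1 ≤ (r⁻¹ • u) v ↔ -r ≤ u v := by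
    intro v
    rw [LinearMap.smul_apply, smul_eq_mul, ← mul_le_mul_iff_right₀ hr, mul_inv_cancel_left₀ hr.ne']
    simp
  simp only [dualPolyhedron, Set.mem_ofPred_eq, h1]
  constructor
  · intro h s
    exact h s (subset_convexHull ℝ _ s.2)
  · intro h
    have : convexHull ℝ (S : Set E) ⊆ {v | -r ≤ u v} :=
      convexHull_min (fun s hs => h ⟨s, hs⟩) (convex_halfSpace_ge u.isLinear _)
    exact fun v hv => this hv

/-- The functionals defining the boundary simplices are vertices of the dual polyhedron. -/
theorem Chart.neg_smul_mem_extremePoints [DecidableEq S] {T : Finset S} {f : E →ₗ[ℝ] S → ℝ}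
    (hf : Chart (fun i : S => (i : E)) T f) (hle : ∀ s : S, ∑ i, f s i ≤ 1) {r : ℝ} (hr : 0 < r) :
    (-r) • (∑ i, (LinearMap.proj i).comp f : Module.Dual ℝ E) ∈
      (r • dualPolyhedron (convexHull ℝ (S : Set E))).extremePoints ℝ := by
  set u : Module.Dual ℝ E := ∑ i, (LinearMap.proj i).comp f with hudef
  have hu : ∀ x, u x = ∑ i, f x i := fun x => by simp [u]
  have huT : ∀ i ∈ T, u i = 1 := fun i hi => by simp [hu, hf.self i hi]
  rw [mem_extremePoints]
  refine ⟨?_, ?_⟩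
  · rw [mem_smul_dualPolyhedron_iff hr]
    intro s
    have := hle s
    rw [← hu] at this
    simp only [LinearMap.smul_apply, smul_eq_mul]
    nlinarith
  · intro x₁ h₁ x₂ h₂ h
    rw [mem_smul_dualPolyhedron_iff hr] at h₁ h₂
    have hext : ∀ y : Module.Dual ℝ E, (∀ i ∈ T, y i = -r) → y = (-r) • u := by
      intro y hy
      ext v
      conv_lhs => rw [← hf.total v]
      simp only [map_sum, map_smul, smul_eq_mul, LinearMap.smul_apply, hu, Finset.mul_sum]
      refine Finset.sum_congr rfl fun i _ => ?_
      by_cases hi : i ∈ T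
      · rw [hy i hi, mul_comm]
      · simp [hf.support v i hi]
    obtain ⟨α, β, hα, hβ, hαβ, h⟩ := h
    have hval : ∀ i ∈ T, x₁ i = -r ∧ x₂ i = -r := by
      intro i hi
      have := congrArg (fun y : Module.Dual ℝ E => y i) h
      simp only [LinearMap.add_apply, LinearMap.smul_apply, smul_eq_mul, huT i hi] at this
      have h1 := h₁ i
      have h2 := h₂ i
      have e : α * (x₁ i + r) + β * (x₂ i + r) = 0 := by linear_combination this + r * hαβ
      have p1 : 0 ≤ α * (x₁ i + r) := mul_nonneg hα.le (by linarith)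
      have p2 : 0 ≤ β * (x₂ i + r) := mul_nonneg hβ.le (by linarith)
      have z1 : α * (x₁ i + r) = 0 := by linarith
      have z2 : β * (x₂ i + r) = 0 := by linarith
      have z1 := (mul_eq_zero.mp z1).resolve_left hα.ne'
      have z2 := (mul_eq_zero.mp z2).resolve_left hβ.ne'
      constructor <;> linarith
    exact ⟨hext x₁ fun i hi => (hval i hi).1, hext x₂ fun i hi => (hval i hi).2⟩

/-- Every vertex of the dual polyhedron is given by the sum of the coordinates in some chart. -/
theorem exists_chart_of_mem_extremePoints [DecidableEq S] {r : ℝ} (hr : 0 < r)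
    {u : Module.Dual ℝ E}
    (hu : u ∈ (r • dualPolyhedron (convexHull ℝ (S : Set E))).extremePoints ℝ) :
    ∃ (T : Finset S) (f : E →ₗ[ℝ] S → ℝ), Chart (fun i : S => (i : E)) T f ∧
      ∀ v, u v = -r * ∑ i, f v i := by
  rw [mem_extremePoints] at hu
  obtain ⟨hmem, hext⟩ := hu
  rw [mem_smul_dualPolyhedron_iff hr] at hmem
  let A : Set S := {s | u s = -r}
  -- If the active constraints did not span, u could be moved both ways along a functional g that
  -- vanishes on them, and would not be extreme.
  have hA : Submodule.span ℝ ((fun i : S => (i : E)) '' A) = ⊤ := by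
    by_contra hne
    obtain ⟨g, hg0, hg⟩ := Submodule.exists_le_ker_of_lt_top _ (lt_top_iff_ne_top.mpr hne)
    have key : ∀ᶠ δ in 𝓝[>] (0 : ℝ), ∀ s : S, -r ≤ (u + δ • g) s ∧ -r ≤ (u - δ • g) s := by
      rw [Filter.eventually_all]
      intro s
      simp only [LinearMap.add_apply, LinearMap.sub_apply, LinearMap.smul_apply, smul_eq_mul]
      by_cases hs : u s = -r
      · have : g s = 0 := hg (Submodule.subset_span ⟨s, hs, rfl⟩)
        simp [this, hs]
      · have hlt : -r < u s := lt_of_le_of_ne (hmem s) (Ne.symm hs)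
        have h1 : ∀ᶠ δ in 𝓝 (0 : ℝ), -r < u s + δ * g s := by
          apply ContinuousAt.eventually_lt (by fun_prop) (by fun_prop)
          simpa using hlt
        have h2 : ∀ᶠ δ in 𝓝 (0 : ℝ), -r < u s - δ * g s := by
          apply ContinuousAt.eventually_lt (by fun_prop) (by fun_prop)
          simpa using hlt
        filter_upwards [(h1.and h2).filter_mono nhdsWithin_le_nhds] with δ hδ
        exact ⟨hδ.1.le, hδ.2.le⟩
    obtain ⟨δ, hδ, hpos⟩ := (key.and self_mem_nhdsWithin).exists
    have hpos : 0 < δ := hpos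
    have := (hext (u + δ • g) ((mem_smul_dualPolyhedron_iff hr).mpr fun s => (hδ s).1)
      (u - δ • g) ((mem_smul_dualPolyhedron_iff hr).mpr fun s => (hδ s).2)
      ⟨1 / 2, 1 / 2, by norm_num, by norm_num, by norm_num, by module⟩).1
    rw [add_eq_left, smul_eq_zero] at this
    exact this.elim hpos.ne' hg0
  obtain ⟨T, f, hf, -, hT⟩ := exists_chart (Set.empty_subset A) hA (linearIndepOn_empty ℝ _)
  refine ⟨T, f, hf, fun v => ?_⟩
  conv_lhs => rw [← hf.total v]
  rw [map_sum, Finset.mul_sum]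
  refine Finset.sum_congr rfl fun i _ => ?_
  by_cases hi : i ∈ T
  · have : u i = -r := hT hi
    rw [map_smul, this, smul_eq_mul, mul_comm]
  · simp [hf.support v i hi]

end Polytope

/-! ### Lattice points of the half-open cones -/

/-- Reduction modulo 1 adapted to a half-open cone: into (0, 1] for a coordinate whose facet is
removed (q), into [0, 1) otherwise. Uniqueness is `eq_of_add_nat_eq`. -/
theorem exists_nat_sub_mem_unit {q : Prop} {t : ℝ} (h0 : 0 ≤ t) (hq : q → 0 < t) :
    ∃ n : ℕ, 0 ≤ t - n ∧ t - n ≤ 1 ∧ (q → 0 < t - n) ∧ (¬ q → t - n < 1) := by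
  by_cases h : q
  · have hc : 0 < ⌈t⌉₊ := Nat.ceil_pos.mpr (hq h)
    have h1 := Nat.le_ceil t
    have h2 := Nat.ceil_lt_add_one h0
    refine ⟨⌈t⌉₊ - 1, ?_⟩
    rw [Nat.cast_sub (by omega)]
    push_cast
    exact ⟨by linarith, by linarith, fun _ => by linarith, fun h' => absurd h h'⟩
  · have h1 := Nat.floor_le h0
    have h2 := Nat.lt_floor_add_one t
    exact ⟨⌊t⌋₊, by linarith, by linarith, fun h' => absurd h' h, fun _ => by linarith⟩

theorem eq_of_add_nat_eq {q : Prop} {s t : ℝ} {m n : ℕ} (h : s + m = t + n)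
    (hs : 0 ≤ s ∧ s ≤ 1 ∧ (q → 0 < s) ∧ (¬ q → s < 1))
    (ht : 0 ≤ t ∧ t ≤ 1 ∧ (q → 0 < t) ∧ (¬ q → t < 1)) : m = n := by
  obtain ⟨s0, s1, s2, s3⟩ := hs
  obtain ⟨t0, t1, t2, t3⟩ := ht
  have h1 : (m : ℝ) < n + 1 := by
    by_cases hq : q
    · have := s2 hq; linarith
    · have := t3 hq; linarith
  have h2 : (n : ℝ) < m + 1 := by
    by_cases hq : q
    · have := t2 hq; linarith
    · have := s3 hq; linarith
  have h1 : m < n + 1 := by exact_mod_cast h1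
  have h2 : n < m + 1 := by exact_mod_cast h2
  omega

theorem finite_inter_lattice {E : Type*} [NormedAddCommGroup E] [NormedSpace ℝ E]
    [FiniteDimensional ℝ E] (L : Submodule ℤ E) [DiscreteTopology L] (R : ℝ) :
    (Metric.closedBall (0 : E) R ∩ (L : Set E)).Finite := by
  have := FiniteDimensional.proper_real E
  change ((_ : Set E) ∩ L.toAddSubgroup).Finite
  have : DiscreteTopology L.toAddSubgroup := (inferInstance : DiscreteTopology L)
  exact Metric.finite_isBounded_inter_isClosed DiscreteTopology.isDiscrete
    Metric.isBounded_closedBall inferInstance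

theorem Chart.mem_closedBall {ι E : Type*} [Fintype ι] [DecidableEq ι] [NormedAddCommGroup E]
    [NormedSpace ℝ E] {a : ι → E} {T : Finset ι} {f : E →ₗ[ℝ] ι → ℝ} (hf : Chart a T f) {v : E}
    (h0 : ∀ i ∈ T, 0 ≤ f v i) (h1 : ∀ i ∈ T, f v i ≤ 1) :
    v ∈ Metric.closedBall (0 : E) (∑ i, ‖a i‖) := by
  rw [mem_closedBall_zero_iff]
  conv_lhs => rw [← hf.total v]
  refine (norm_sum_le _ _).trans (Finset.sum_le_sum fun i _ => ?_)
  rw [norm_smul]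
  refine mul_le_of_le_one_left (norm_nonneg _) ?_
  rw [Real.norm_eq_abs]
  by_cases hi : i ∈ T
  · exact abs_le.mpr ⟨by linarith [h0 i hi], h1 i hi⟩
  · simp [hf.support v i hi]

/-- The coordinates of lattice points in all charts have a common denominator. -/
theorem exists_common_denominator {ι E : Type*} [Fintype ι] [DecidableEq ι]
    [NormedAddCommGroup E] [NormedSpace ℝ E] [FiniteDimensional ℝ E] (L : Submodule ℤ E)
    [DiscreteTopology L] {a : ι → E} (ha : ∀ i, a i ∈ L) :
    ∃ r : ℕ, 0 < r ∧ ∀ T f, Chart a T f → ∀ v ∈ L, ∀ i, ∃ k : ℤ, r * f v i = k := by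
  classical
  have hfin := finite_inter_lattice L (∑ i, ‖a i‖)
  set X := hfin.toFinset
  refine ⟨X.card.factorial, Nat.factorial_pos _, fun T f hf v hv i => ?_⟩
  by_cases hi : i ∈ T
  swap; · exact ⟨0, by simp [hf.support v i hi]⟩
  -- The multiples of v reduced modulo the generators stay in the finite set X. Two among the first
  -- |X| + 1 coincide, so some n - m ≤ |X| clears the denominators, and it divides |X|!, which does
  -- not depend on the chart or on v.
  let g : ℕ → E := fun k => (k : ℝ) • v - ∑ j, (if j ∈ T then ⌊f ((k : ℝ) • v) j⌋ else 0) • a j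
  have hfg : ∀ k, ∀ j ∈ T, f (g k) j = Int.fract (f ((k : ℝ) • v) j) := by
    intro k j hj
    have : ∑ j, (if j ∈ T then ⌊f ((k : ℝ) • v) j⌋ else 0) • a j
        = ∑ j, (if j ∈ T then (⌊f ((k : ℝ) • v) j⌋ : ℝ) else 0) • a j :=
      Finset.sum_congr rfl fun j _ => by split_ifs <;> simp [Int.cast_smul_eq_zsmul]
    simp only [g]
    rw [map_sub, this, hf.apply_sum (fun i hi => if_neg hi), Pi.sub_apply, if_pos hj]
    rfl
  have hgX : ∀ k, g k ∈ X := by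
    intro k
    rw [Set.Finite.mem_toFinset]
    refine ⟨hf.mem_closedBall (fun j hj => ?_) (fun j hj => ?_), ?_⟩
    · rw [hfg k j hj]; exact Int.fract_nonneg _
    · rw [hfg k j hj]; exact (Int.fract_lt_one _).le
    · refine L.sub_mem ?_ (L.sum_mem fun j _ => L.smul_mem _ (ha j))
      rw [Nat.cast_smul_eq_nsmul]
      exact L.nsmul_mem hv k
  obtain ⟨m, hm, n, hn, hmn, he⟩ := Finset.exists_ne_map_eq_of_card_lt_of_maps_to
    (s := Finset.range (X.card + 1)) (t := X) (f := g) (by simp) (fun k _ => hgX k)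
  wlog hlt : m < n generalizing m n
  · exact this n hn m hm hmn.symm he.symm (lt_of_le_of_ne (not_lt.mp hlt) hmn.symm)
  have h1 := congrArg (fun x => f x i) he
  simp only [hfg _ i hi] at h1
  simp only [map_smul, Pi.smul_apply, smul_eq_mul] at h1
  obtain ⟨z, hz⟩ := Int.fract_eq_fract.mp h1
  rw [Finset.mem_range] at hm hn
  obtain ⟨c, hc⟩ := Nat.dvd_factorial (n := X.card) (m := n - m) (by omega) (by omega)
  refine ⟨-(c * z), ?_⟩
  rw [hc]
  push_cast [Nat.cast_sub hlt.le]
  linear_combination (-(c : ℝ)) * hz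

theorem dualDenominators_nonempty {E : Type*} [NormedAddCommGroup E] [NormedSpace ℝ E]
    [FiniteDimensional ℝ E] {L : Submodule ℤ E} [DiscreteTopology L] {P : Set E}
    (hP : IsFullLatticePolytope L P) : (dualDenominators L P).Nonempty := by
  classical
  obtain ⟨S, hSL, rfl⟩ := hP.exists_conv
  obtain ⟨r, hr, h⟩ := exists_common_denominator L (a := fun i : S => (i : E))
    (fun i => hSL i.2)
  have hr' : (0 : ℝ) < r := by exact_mod_cast hr
  refine ⟨r, hr, fun u hu v hv => ?_⟩
  obtain ⟨T, f, hf, hu⟩ := exists_chart_of_mem_extremePoints hr' hu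
  choose k hk using h T f hf v hv
  refine ⟨-∑ i, k i, ?_⟩
  rw [hu, neg_mul, Finset.mul_sum]
  push_cast
  simp [hk]

theorem isLeast_dualIndex {E : Type*} [NormedAddCommGroup E] [NormedSpace ℝ E]
    [FiniteDimensional ℝ E] {L : Submodule ℤ E} [DiscreteTopology L] {P : Set E}
    (hP : IsFullLatticePolytope L P) : IsLeast (dualDenominators L P) (dualIndex L P) :=
  ⟨Nat.sInf_mem (dualDenominators_nonempty hP), fun _ h => Nat.sInf_le h⟩

/-- A parametrisation of the lattice points of the cone over `P` by finitely many copies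
of `ℕ ^ d`, on each of which the gauge of `P` is a constant plus the sum of the coordinates. -/
structure IsConeParam {E : Type*} [AddCommGroup E] [Module ℝ E] (L : Submodule ℤ E) (P : Set E)
    {k d : ℕ} (e : Fin k → ℚ≥0) (Φ : Fin k × (Fin d → ℕ) → E) : Prop where
  injective : Function.Injective Φ
  mem_lattice : ∀ x, Φ x ∈ L
  exists_eq : ∀ v ∈ L, ∀ lam : ℝ, 0 ≤ lam → v ∈ lam • P → ∃ x, Φ x = v
  mem_smul_iff : ∀ x, ∀ lam : ℝ, 0 ≤ lam →
    (Φ x ∈ lam • P ↔ (e x.1 : ℝ) + (∑ j, x.2 j : ℕ) ≤ lam)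

/-- Each lattice point of a half-open cone is uniquely a lattice point p of its half-open box plus a
combination of the generators with coefficients in ℕ. The indices i are the pairs (cone, p), and e i
is the gauge of p. -/
theorem exists_isConeParam {E : Type*} [NormedAddCommGroup E] [NormedSpace ℝ E]
    [FiniteDimensional ℝ E] {L : Submodule ℤ E} [DiscreteTopology L] {P : Set E}
    (hP : IsFullLatticePolytope L P) :
    ∃ (k : ℕ) (e : Fin k → ℚ≥0) (Φ : Fin k × (Fin (Module.finrank ℝ E) → ℕ) → E),
      IsConeParam L P e Φ ∧
      ∀ r ∈ dualDenominators L P, ∀ i, ∃ m : ℕ, (r : ℚ≥0) * e i = m := by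
  classical
  obtain ⟨r₀, hr₀⟩ := dualDenominators_nonempty hP
  obtain ⟨S, hSL, rfl⟩ := hP.exists_conv
  have h0 := hP.zero_mem
  obtain ⟨w, G, hG, hex, huniq⟩ :=
    exists_halfOpen_triangulation (span_coe_eq_top hP.affineSpan_eq_top)
  set a : S → E := fun i => (i : E) with ha
  have haL : ∀ i, a i ∈ L := fun i => hSL i.2
  -- a chart and an enumeration for each simplex
  have hβ : ∀ T : Finset S, ∃ (f : E →ₗ[ℝ] S → ℝ) (β : Fin (Module.finrank ℝ E) → S),
      (∃ f, G T f) → G T f ∧ Function.Injective β ∧ ∀ i, i ∈ T ↔ ∃ j, β j = i := by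
    intro T
    by_cases hT : ∃ f, G T f
    swap
    -- Junk values for the sets T that carry no simplex.
    · by_cases hd : Nonempty (Fin (Module.finrank ℝ E) → S)
      · exact ⟨0, hd.some, fun h => absurd h hT⟩
      · exfalso
        apply hd
        have hne : (S : Set E).Nonempty := convexHull_nonempty_iff.mp ⟨0, h0⟩
        exact ⟨fun _ => ⟨hne.some, hne.some_mem⟩⟩
    · obtain ⟨f, hf⟩ := hT
      have hc := (hG T f hf).1
      let φ : E ≃ₗ[ℝ] (T → ℝ) := LinearEquiv.ofLinearMap
        (LinearMap.pi fun i : T => (LinearMap.proj (i : S)).comp f)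
        (∑ i : T, (LinearMap.proj i : (T → ℝ) →ₗ[ℝ] ℝ).smulRight (a i))
        (by
          ext1 i
          ext x
          by_cases hx : i = x
          · subst hx
            simp [Finset.sum_apply, Pi.single_apply, hc.self i i.2, ite_smul]
          · simp [Finset.sum_apply, Pi.single_apply, ite_smul, hc.self i i.2, Ne.symm hx])
        (by
          ext v
          simp only [LinearMap.comp_apply, LinearMap.sum_apply, LinearMap.smulRight_apply,
            LinearMap.proj_apply, LinearMap.pi_apply, LinearMap.id_apply]
          conv_rhs => rw [← hc.total v]
          rw [Finset.sum_coe_sort T (fun i => f v i • a i)]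
          refine Finset.sum_subset (Finset.subset_univ T) fun i _ hi => ?_
          rw [hc.support v i hi, zero_smul])
      have hcard : T.card = Module.finrank ℝ E := by
        rw [φ.finrank_eq]; simp
      refine ⟨f, fun j => (T.equivFin.symm (Fin.cast hcard.symm j) : S), fun _ => ⟨hf, ?_, ?_⟩⟩
      · intro i j hij
        simpa [Fin.ext_iff] using T.equivFin.symm.injective (Subtype.ext hij)
      · intro i
        constructor
        · intro hi
          exact ⟨Fin.cast hcard (T.equivFin ⟨i, hi⟩), by simp⟩
        · rintro ⟨j, rfl⟩
          exact Subtype.prop _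
  choose F β hFβ using hβ
  have hF : ∀ T f, G T f → F T = f := fun T f h =>
    (hG T _ (hFβ T ⟨f, h⟩).1).1.unique (hG T f h).1
  -- the points of the half-open boxes
  let Box : Finset S → E → Prop := fun T p => (∃ f, G T f) ∧ p ∈ L ∧ ∀ i ∈ T,
    0 ≤ F T p i ∧ F T p i ≤ 1 ∧ (F T w i < 0 → 0 < F T p i) ∧ (¬ F T w i < 0 → F T p i < 1)
  let I := {x : Finset S × E // Box x.1 x.2}
  have hfinI : Finite I := by
    have : {x : Finset S × E | Box x.1 x.2} ⊆
        Set.univ ×ˢ (Metric.closedBall (0 : E) (∑ i, ‖a i‖) ∩ (L : Set E)) := by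
      rintro ⟨T, p⟩ ⟨hT, hp, h⟩
      exact ⟨trivial, (hG T _ (hFβ T hT).1).1.mem_closedBall (fun i hi => (h i hi).1)
        (fun i hi => (h i hi).2.1), hp⟩
    exact ((Set.finite_univ.prod (finite_inter_lattice L _)).subset this).to_subtype
  obtain ⟨k, ⟨σ⟩⟩ := Finite.exists_equiv_fin I
  -- the value of the gauge on the points of the boxes
  have hint : ∀ r ∈ dualDenominators L (convexHull ℝ (S : Set E)), ∀ x : I,
      ∃ m : ℕ, (r : ℝ) * ∑ i, F x.1.1 x.1.2 i = m := by
    rintro r ⟨hr, hrL⟩ ⟨⟨T, p⟩, hT, hp, h⟩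
    have hr' : (0 : ℝ) < r := by exact_mod_cast hr
    obtain ⟨hc, hle⟩ := hG T _ (hFβ T hT).1
    -- Minus r times the coordinate sum is a vertex of rP^∨, hence integral on L.
    obtain ⟨z, hz⟩ := hrL (hc.neg_smul_mem_extremePoints hle hr') p hp
    simp only [LinearMap.smul_apply, LinearMap.sum_apply, LinearMap.comp_apply,
      LinearMap.proj_apply, smul_eq_mul] at hz
    have hnn : 0 ≤ ∑ i, F T p i := Finset.sum_nonneg fun i _ => by
      by_cases hi : i ∈ T
      · exact (h i hi).1
      · rw [hc.support p i hi]
    have hz' : ((-z : ℤ) : ℝ) = r * ∑ i, F T p i := by push_cast; linarith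
    have hz0 : 0 ≤ -z := by
      have : (0 : ℝ) ≤ ((-z : ℤ) : ℝ) := by rw [hz']; positivity
      exact_mod_cast this
    refine ⟨(-z).toNat, ?_⟩
    rw [← hz']
    exact_mod_cast (Int.toNat_of_nonneg hz0).symm
  have he : ∀ x : I, ∃ q : ℚ≥0, (q : ℝ) = ∑ i, F x.1.1 x.1.2 i := by
    intro x
    obtain ⟨m, hm⟩ := hint r₀ hr₀ x
    have hr' : (r₀ : ℝ) ≠ 0 := by exact_mod_cast hr₀.1.ne'
    refine ⟨m / r₀, ?_⟩
    push_cast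
    rw [← hm, mul_div_cancel_left₀ _ hr']
  choose e he using he
  let Φ : I × (Fin (Module.finrank ℝ E) → ℕ) → E := fun x =>
    x.1.1.2 + ∑ j, x.2 j • a (β x.1.1.1 j)
  have hΦ1 : ∀ T p (hB : Box T p) (n : Fin (Module.finrank ℝ E) → ℕ) j,
      F T (p + ∑ j, n j • a (β T j)) (β T j) = F T p (β T j) + n j := by
    rintro T p ⟨hT, hp, h⟩ n j
    obtain ⟨hGF, hinj, hran⟩ := hFβ T hT
    obtain ⟨hc, hle⟩ := hG T _ hGF
    rw [map_add, Pi.add_apply, map_sum, Finset.sum_apply]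
    congr 1
    rw [Finset.sum_eq_single j]
    · rw [map_nsmul, hc.self _ ((hran _).mpr ⟨j, rfl⟩)]
      simp
    · intro i _ hij
      rw [map_nsmul, hc.self _ ((hran _).mpr ⟨i, rfl⟩)]
      simp [hinj.ne hij.symm]
    · simp
  have hΦ2 : ∀ T p (hB : Box T p) (n : Fin (Module.finrank ℝ E) → ℕ),
      InCell w T (F T) (p + ∑ j, n j • a (β T j)) := by
    intro T p hB n i hi
    obtain ⟨j, rfl⟩ := ((hFβ T hB.1).2.2 i).mp hi
    rw [hΦ1 T p hB]
    obtain ⟨h1, -, h2, -⟩ := hB.2.2 _ hi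
    have : (0 : ℝ) ≤ n j := Nat.cast_nonneg _
    exact ⟨by linarith, fun h => by linarith [h2 h]⟩
  have hΦ3 : ∀ T p (hB : Box T p) (n : Fin (Module.finrank ℝ E) → ℕ),
      ∑ i, F T (p + ∑ j, n j • a (β T j)) i = ∑ i, F T p i + (∑ j, n j : ℕ) := by
    rintro T p hB n
    obtain ⟨hGF, hinj, hran⟩ := hFβ T hB.1
    obtain ⟨hc, hle⟩ := hG T _ hGF
    simp only [map_add, Pi.add_apply, Finset.sum_add_distrib, map_sum, Finset.sum_apply,
      Nat.cast_sum]
    congr 1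
    rw [Finset.sum_comm]
    refine Finset.sum_congr rfl fun j _ => ?_
    rw [map_nsmul, hc.self _ ((hran _).mpr ⟨j, rfl⟩)]
    simp [Pi.single_apply]
  have hinjΦ : Function.Injective Φ := by
    rintro ⟨⟨⟨T, p⟩, hB⟩, n⟩ ⟨⟨⟨T', p'⟩, hB'⟩, n'⟩ h
    simp only [Φ] at h
    have hTT : T = T' := huniq T (F T) T' (F T') _ (hFβ T hB.1).1 (hFβ T' hB'.1).1
      (hΦ2 T p hB n) (by rw [h]; exact hΦ2 T' p' hB' n')
    subst hTT
    have hn : n = n' := by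
      ext j
      have h1 := hΦ1 T p hB n j
      rw [h, hΦ1 T p' hB' n' j] at h1
      have hj : β T j ∈ T := ((hFβ T hB.1).2.2 _).mpr ⟨j, rfl⟩
      exact eq_of_add_nat_eq h1.symm (hB.2.2 _ hj) (hB'.2.2 _ hj)
    subst hn
    have hp : p = p' := by simpa using h
    subst hp
    rfl
  refine ⟨k, fun i => e (σ.symm i), fun x => Φ (σ.symm x.1, x.2), ⟨?_, ?_, ?_, ?_⟩, ?_⟩
  · rintro ⟨i, n⟩ ⟨i', n'⟩ h
    have := hinjΦ h
    simpa using this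
  · rintro ⟨i, n⟩
    exact L.add_mem (σ.symm i).2.2.1 (L.sum_mem fun j _ => L.nsmul_mem (haL _) _)
  · intro v hv lam hlam hvP
    obtain ⟨μ, hμ0, -, hμ⟩ := (mem_smul_convexHull_iff h0 hlam).mp hvP
    obtain ⟨T, f, hT, hcell⟩ := hex μ hμ0
    rw [hμ] at hcell
    obtain ⟨hGF, hinj, hran⟩ := hFβ T ⟨f, hT⟩
    obtain rfl := hF T f hT
    obtain ⟨hc, hle⟩ := hG T _ hGF
    choose n hn using fun j => exists_nat_sub_mem_unit (q := F T w (β T j) < 0)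
      (hcell _ ((hran _).mpr ⟨j, rfl⟩)).1 (hcell _ ((hran _).mpr ⟨j, rfl⟩)).2
    have hval : ∀ j, F T (v - ∑ j, n j • a (β T j)) (β T j) = F T v (β T j) - n j := by
      intro j
      rw [map_sub, Pi.sub_apply, map_sum, Finset.sum_apply]
      congr 1
      rw [Finset.sum_eq_single j]
      · rw [map_nsmul, hc.self _ ((hran _).mpr ⟨j, rfl⟩)]
        simp
      · intro i _ hij
        rw [map_nsmul, hc.self _ ((hran _).mpr ⟨i, rfl⟩)]
        simp [hinj.ne hij.symm]
      · simp
    have hB : Box T (v - ∑ j, n j • a (β T j)) := by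
      refine ⟨⟨_, hGF⟩, L.sub_mem hv (L.sum_mem fun j _ => L.nsmul_mem (haL _) _), ?_⟩
      intro i hi
      obtain ⟨j, rfl⟩ := (hran i).mp hi
      rw [hval]
      exact hn j
    exact ⟨(σ ⟨(T, _), hB⟩, n), by simp [Φ]⟩
  · rintro ⟨i, n⟩ lam hlam
    obtain ⟨⟨⟨T, p⟩, hB⟩, hi⟩ : ∃ x, σ.symm i = x := ⟨_, rfl⟩
    simp only [hi, Φ]
    obtain ⟨hGF, hinj, hran⟩ := hFβ T hB.1
    obtain ⟨hc, hle⟩ := hG T _ hGF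
    have hcell := hΦ2 T p hB n
    rw [hc.mem_smul_iff h0 hle (fun i => ?_) hlam, hΦ3 T p hB, he]
    by_cases hi : i ∈ T
    · exact (hcell i hi).1
    · rw [hc.support _ i hi]
  · intro r hr i
    obtain ⟨m, hm⟩ := hint r hr (σ.symm i)
    refine ⟨m, ?_⟩
    rw [← he] at hm
    exact_mod_cast hm

/-! ### Counting solutions in ℕ^d -/

section Counting

theorem finite_setOf_sum_le {ι : Type*} [Fintype ι] (m : ℕ) :
    {n : ι → ℕ | ∑ i, n i ≤ m}.Finite := by
  classical
  exact (Set.finite_Icc (0 : ι → ℕ) fun _ => m).subset fun n hn =>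
    ⟨fun _ => Nat.zero_le _, fun i =>
      (Finset.single_le_sum (fun _ _ => Nat.zero_le _) (Finset.mem_univ i)).trans hn⟩

theorem ncard_sum_eq {ι : Type*} [Fintype ι] (m : ℕ) :
    ({n : ι → ℕ | ∑ i, n i = m}.ncard : ℤ) =
      PowerSeries.coeff m ((PowerSeries.mk 1 : PowerSeries ℤ) ^ Fintype.card ι) := by
  classical
  rw [← Finset.card_univ, ← Finset.prod_const, PowerSeries.coeff_prod]
  have : {n : ι → ℕ | ∑ i, n i = m} =
      (((Finset.finsuppAntidiag Finset.univ m).image fun l : ι →₀ ℕ => (l : ι → ℕ) :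
        Finset (ι → ℕ)) : Set (ι → ℕ)) := by
    ext n
    simp only [Set.mem_ofPred_eq, Finset.coe_image, Set.mem_image, Finset.mem_coe,
      Finset.mem_finsuppAntidiag]
    constructor
    · intro h
      exact ⟨Finsupp.equivFunOnFinite.symm n, by simpa using h, rfl⟩
    · rintro ⟨l, hl, rfl⟩
      exact hl.1
  rw [this, Set.ncard_coe_finset, Finset.card_image_of_injective _ DFunLike.coe_injective]
  simp

/-- A slack variable, indexed by `none`, turns the inequality into an equation; this accounts for
the extra factor 1/(1 - t). -/
theorem ncard_add_sum_le {ι : Type*} [Fintype ι] (c m : ℕ) :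
    ({n : ι → ℕ | c + ∑ i, n i ≤ m}.ncard : ℤ) = PowerSeries.coeff m
      (PowerSeries.X ^ c * (PowerSeries.mk 1 : PowerSeries ℤ) ^ (Fintype.card ι + 1)) := by
  rw [PowerSeries.coeff_X_pow_mul']
  split_ifs with h
  · have e : {n : ι → ℕ | c + ∑ i, n i ≤ m} =
        (fun (N : Option ι → ℕ) i => N (some i)) '' {N | ∑ i, N i = m - c} := by
      ext n
      simp only [Set.mem_ofPred_eq, Set.mem_image]
      constructor
      · intro hn
        refine ⟨fun o => o.elim (m - c - ∑ i, n i) n, ?_, rfl⟩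
        rw [Fintype.sum_option]
        simp only [Option.elim_none, Option.elim_some]
        omega
      · rintro ⟨N, hN, rfl⟩
        rw [Fintype.sum_option] at hN
        dsimp only
        omega
    rw [e, Set.InjOn.ncard_image, ncard_sum_eq, Fintype.card_option]
    intro N hN N' hN' hNN
    simp only [Set.mem_ofPred_eq, Fintype.sum_option] at hN hN'
    have h1 : ∀ i, N (some i) = N' (some i) := fun i => congrFun hNN i
    simp only [h1] at hN
    funext o
    cases o with
    | none => omega
    | some i => exact h1 i
  · have : {n : ι → ℕ | c + ∑ i, n i ≤ m} = ∅ := by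
      ext n
      simp only [Set.mem_ofPred_eq, Set.mem_empty_iff_false, iff_false]
      omega
    simp [this]

theorem ncard_fibers {α β : Type*} [Fintype α] {A : α → Set β} (hA : ∀ a, (A a).Finite) :
    {x : α × β | x.2 ∈ A x.1}.ncard = ∑ a, (A a).ncard := by
  have := fun a => (hA a).to_subtype
  simp only [← Nat.card_coe_set_eq]
  rw [← Nat.card_sigma]
  exact Nat.card_congr
    { toFun := fun x => ⟨x.1.1, x.1.2, x.2⟩
      invFun := fun x => ⟨(x.1, x.2.1), x.2.2⟩
      left_inv := fun _ => rfl
      right_inv := fun _ => rfl }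

end Counting

/-! ### Polynomials and series with fractional exponents -/

section FracPoly

theorem mulSeries_zero (c : ℚ≥0 → ℤ) (lam : ℚ≥0) : FracPoly.mulSeries 0 c lam = 0 := by
  simp [FracPoly.mulSeries]

theorem mulSeries_add (p q : FracPoly) (c : ℚ≥0 → ℤ) (lam : ℚ≥0) :
    FracPoly.mulSeries (p + q) c lam =
      FracPoly.mulSeries p c lam + FracPoly.mulSeries q c lam := by
  unfold FracPoly.mulSeries
  rw [AddMonoidAlgebra.coeff_add]
  apply Finsupp.sum_add_index'
  · simp
  · intro j a b
    split_ifs <;> ring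

theorem mulSeries_sub (p q : FracPoly) (c : ℚ≥0 → ℤ) (lam : ℚ≥0) :
    FracPoly.mulSeries (p - q) c lam =
      FracPoly.mulSeries p c lam - FracPoly.mulSeries q c lam := by
  rw [eq_sub_iff_add_eq, ← mulSeries_add, sub_add_cancel]

theorem mulSeries_single (j : ℚ≥0) (a : ℤ) (c : ℚ≥0 → ℤ) (lam : ℚ≥0) :
    FracPoly.mulSeries (AddMonoidAlgebra.single j a) c lam =
      if j ≤ lam then a * c (lam - j) else 0 := by
  unfold FracPoly.mulSeries
  rw [AddMonoidAlgebra.coeff_single]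
  apply Finsupp.sum_single_index
  simp

theorem mulSeries_one (c : ℚ≥0 → ℤ) : FracPoly.mulSeries 1 c = c := by
  funext lam
  rw [AddMonoidAlgebra.one_def, mulSeries_single]
  simp

theorem mulSeries_series_add (p : FracPoly) (c c' : ℚ≥0 → ℤ) :
    FracPoly.mulSeries p (c + c') = FracPoly.mulSeries p c + FracPoly.mulSeries p c' := by
  funext lam
  simp only [FracPoly.mulSeries, Pi.add_apply]
  rw [← Finsupp.sum_add]
  refine Finsupp.sum_congr fun j _ => ?_
  split_ifs <;> ring

/-- The formal series form a module over the fractional polynomials; powers of 1 - t can thus be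
applied one factor at a time. -/
theorem mulSeries_mul (p q : FracPoly) (c : ℚ≥0 → ℤ) :
    FracPoly.mulSeries (p * q) c = FracPoly.mulSeries p (FracPoly.mulSeries q c) := by
  induction p using AddMonoidAlgebra.induction_linear with
  | zero => funext lam; rw [zero_mul, mulSeries_zero, mulSeries_zero]
  | add p p' hp hp' =>
    funext lam
    rw [add_mul, mulSeries_add, hp, hp', mulSeries_add]
  | single j a =>
    induction q using AddMonoidAlgebra.induction_linear with
    | zero =>
      funext lam
      rw [mul_zero, mulSeries_zero, mulSeries_single]
      simp [mulSeries_zero]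
    | add q q' hq hq' =>
      have : FracPoly.mulSeries (q + q') c =
          FracPoly.mulSeries q c + FracPoly.mulSeries q' c :=
        funext fun lam => mulSeries_add q q' c lam
      rw [this, mulSeries_series_add, ← hq, ← hq', mul_add]
      exact funext fun lam => mulSeries_add _ _ c lam
    | single j' a' =>
      funext lam
      rw [AddMonoidAlgebra.single_mul_single, mulSeries_single, mulSeries_single]
      by_cases h : j ≤ lam
      · rw [if_pos h, mulSeries_single]
        by_cases h' : j + j' ≤ lam
        · rw [if_pos h', if_pos (le_tsub_of_add_le_left h'), tsub_add_eq_tsub_tsub]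
          ring
        · rw [if_neg h', if_neg fun h2 => h' (add_comm j j' ▸ add_le_of_le_tsub_right_of_le h h2),
            mul_zero]
      · rw [if_neg h, if_neg fun h' => h (le_self_add.trans h')]

open Classical in
/-- The coefficients of `t ^ e * f`, as a series with fractional exponents. -/
noncomputable def shiftSeries (e : ℚ≥0) (f : PowerSeries ℤ) (lam : ℚ≥0) : ℤ :=
  if h : ∃ m : ℕ, lam = e + m then PowerSeries.coeff h.choose f else 0

theorem shiftSeries_add_nat (e : ℚ≥0) (f : PowerSeries ℤ) (m : ℕ) :
    shiftSeries e f (e + m) = PowerSeries.coeff m f := by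
  have h : ∃ m' : ℕ, e + m = e + (m' : ℚ≥0) := ⟨m, rfl⟩
  have h2 : (m : ℚ≥0) = h.choose := add_left_cancel h.choose_spec
  have h3 : m = h.choose := by exact_mod_cast h2
  rw [shiftSeries, dif_pos h, ← h3]

theorem shiftSeries_of_not {e : ℚ≥0} (f : PowerSeries ℤ) {lam : ℚ≥0}
    (h : ¬ ∃ m : ℕ, lam = e + m) : shiftSeries e f lam = 0 := dif_neg h

/-- Multiplication by t preserves the coset e + ℕ of exponents, so on series supported there it is
ordinary power series multiplication. -/
theorem mulSeries_one_sub_single (e : ℚ≥0) (f : PowerSeries ℤ) :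
    FracPoly.mulSeries (1 - AddMonoidAlgebra.single (1 : ℚ≥0) (1 : ℤ)) (shiftSeries e f) =
      shiftSeries e ((1 - PowerSeries.X) * f) := by
  funext lam
  rw [mulSeries_sub, mulSeries_one, mulSeries_single]
  by_cases h : ∃ m : ℕ, lam = e + m
  · obtain ⟨m, rfl⟩ := h
    rw [shiftSeries_add_nat, shiftSeries_add_nat, sub_mul, map_sub]
    simp only [one_mul]
    congr 1
    cases m with
    | zero =>
      rw [PowerSeries.coeff_zero_X_mul]
      split_ifs with h1
      · rw [shiftSeries_of_not]
        rintro ⟨m, hm⟩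
        rw [tsub_eq_iff_eq_add_of_le h1] at hm
        have : (0 : ℚ≥0) = m + 1 := by
          apply add_left_cancel (a := e)
          rw [← add_assoc, ← hm]; simp
        exact (by positivity : (m : ℚ≥0) + 1 ≠ 0) this.symm
      · rfl
    | succ m =>
      rw [PowerSeries.coeff_succ_X_mul, Nat.cast_succ, ← add_assoc, if_pos le_add_self,
        add_tsub_cancel_right, shiftSeries_add_nat]
  · rw [shiftSeries_of_not _ h, shiftSeries_of_not _ h]
    split_ifs with h1
    · rw [shiftSeries_of_not, mul_zero, sub_zero]
      rintro ⟨m, hm⟩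
      refine h ⟨m + 1, ?_⟩
      rw [tsub_eq_iff_eq_add_of_le h1] at hm
      rw [hm]; push_cast; ring
    · rfl

theorem mulSeries_one_sub_single_pow (d : ℕ) (e : ℚ≥0) (f : PowerSeries ℤ) :
    FracPoly.mulSeries ((1 - AddMonoidAlgebra.single (1 : ℚ≥0) (1 : ℤ)) ^ d) (shiftSeries e f) =
      shiftSeries e ((1 - PowerSeries.X) ^ d * f) := by
  induction d generalizing f with
  | zero => rw [pow_zero, pow_zero, mulSeries_one, one_mul]
  | succ d ih =>
    rw [pow_succ, pow_succ, mulSeries_mul, mulSeries_one_sub_single, ih, mul_assoc]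

theorem shiftSeries_one (e lam : ℚ≥0) :
    shiftSeries e 1 lam = (AddMonoidAlgebra.single e 1 : FracPoly).coeff lam := by
  rw [AddMonoidAlgebra.coeff_single, Finsupp.single_apply]
  by_cases h : ∃ m : ℕ, lam = e + m
  · obtain ⟨m, rfl⟩ := h
    rw [shiftSeries_add_nat, PowerSeries.coeff_one]
    simp
  · rw [shiftSeries_of_not _ h, if_neg]
    rintro rfl
    exact h ⟨0, by simp⟩

theorem mulSeries_sum {ι : Type*} (s : Finset ι) (p : FracPoly) (c : ι → ℚ≥0 → ℤ) :
    FracPoly.mulSeries p (∑ i ∈ s, c i) = ∑ i ∈ s, FracPoly.mulSeries p (c i) := by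
  classical
  induction s using Finset.induction_on with
  | empty =>
    funext lam
    simp [FracPoly.mulSeries]
  | insert i s hi ih => rw [Finset.sum_insert hi, Finset.sum_insert hi, mulSeries_series_add, ih]

theorem evalReal_add (x : ℝ) (p q : FracPoly) :
    (p + q).evalReal x = p.evalReal x + q.evalReal x := by
  unfold FracPoly.evalReal
  rw [AddMonoidAlgebra.coeff_add]
  apply Finsupp.sum_add_index'
  · simp
  · intro j a b
    push_cast; ring

theorem evalReal_single (x : ℝ) (j : ℚ≥0) (a : ℤ) :
    FracPoly.evalReal x (AddMonoidAlgebra.single j a) = a * x ^ (j : ℝ) := by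
  unfold FracPoly.evalReal
  rw [AddMonoidAlgebra.coeff_single]
  apply Finsupp.sum_single_index
  simp

theorem evalReal_sum_single {ι : Type*} (s : Finset ι) (e : ι → ℚ≥0) (x : ℝ) :
    FracPoly.evalReal x (∑ i ∈ s, AddMonoidAlgebra.single (e i) 1) =
      ∑ i ∈ s, x ^ (e i : ℝ) := by
  classical
  induction s using Finset.induction_on with
  | empty => simp [FracPoly.evalReal]
  | insert i s hi ih =>
    rw [Finset.sum_insert hi, Finset.sum_insert hi, evalReal_add, ih, evalReal_single]
    simp

/-- A polynomial with fractional exponents is determined by its values. -/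
theorem eq_of_evalReal_eq {p q : FracPoly} (h : ∀ x : ℝ, 0 < x → p.evalReal x = q.evalReal x) :
    p = q := by
  have hz : ∀ x : ℝ, 0 < x → (p - q).evalReal x = 0 := by
    intro x hx
    have := evalReal_add x (p - q) q
    rw [sub_add_cancel, h x hx] at this
    linarith
  rw [← sub_eq_zero]
  set r := p - q
  -- With x = exp t, the monomials become the distinct characters t ↦ exp(jt), which are linearly
  -- independent.
  let χ : ℚ≥0 → (Multiplicative ℝ →* ℝ) := fun j =>
    { toFun := fun t => Real.exp ((j : ℝ) * t.toAdd)
      map_one' := by simp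
      map_mul' := fun s t => by simp [mul_add, Real.exp_add] }
  have hχ : Function.Injective χ := by
    intro i j hij
    have := DFunLike.congr_fun hij (Multiplicative.ofAdd 1)
    simpa [χ] using this
  have hli := (linearIndependent_monoidHom (Multiplicative ℝ) ℝ).comp χ hχ
  rw [linearIndependent_iff] at hli
  have h0 := hli (r.coeff.mapRange (Int.castRingHom ℝ) (map_zero _)) (by
    funext t
    have := hz (Real.exp t.toAdd) (Real.exp_pos _)
    rw [Finsupp.linearCombination_apply, Finsupp.sum_mapRange_index (by simp)]
    simp only [Finsupp.sum, Finset.sum_apply, Pi.smul_apply, Pi.zero_apply]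
    rw [← this, FracPoly.evalReal, Finsupp.sum]
    refine Finset.sum_congr rfl fun j _ => ?_
    rw [← Real.exp_mul, mul_comm (Multiplicative.toAdd t)]
    rfl)
  ext j
  have := DFunLike.congr_fun h0 j
  simpa using this

end FracPoly

/-! ### The gauge and the dimension of the free sum -/

section Geometry

variable {E : Type*} [AddCommGroup E] [Module ℝ E] {P : Set E}

theorem IsFullLatticePolytope.convex {L : Submodule ℤ E} (hP : IsFullLatticePolytope L P) :
    Convex ℝ P := by
  obtain ⟨S, -, rfl⟩ := hP.exists_conv
  exact convex_convexHull ℝ _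

theorem IsFullLatticePolytope.span_eq_top {L : Submodule ℤ E} (hP : IsFullLatticePolytope L P) :
    Submodule.span ℝ P = ⊤ := by
  have h1 : affineSpan ℝ P ≤ (Submodule.span ℝ P).toAffineSubspace :=
    affineSpan_le.mpr Submodule.subset_span
  rw [hP.affineSpan_eq_top] at h1
  exact eq_top_iff.mpr fun v _ => h1 (AffineSubspace.mem_top ℝ E v)

theorem IsFullLatticePolytope.polyDim_eq {L : Submodule ℤ E} (hP : IsFullLatticePolytope L P) :
    polyDim P = Module.finrank ℝ E := polyDim_eq_finrank hP.zero_mem hP.span_eq_top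

/-- The right side describes a convex set that contains every copy of P. Conversely its points are
convex combinations of points of the copies, with the leftover weight on the origin. -/
theorem mem_freeSumPower_iff (hP : Convex ℝ P) (h0 : (0 : E) ∈ P) {n : ℕ} (hn : 0 < n)
    {w : Fin n → E} :
    w ∈ freeSumPower P n ↔
      ∃ l : Fin n → ℝ, (∀ j, 0 ≤ l j) ∧ ∑ j, l j ≤ 1 ∧ ∀ j, w j ∈ l j • P := by
  constructor
  · have hconv : Convex ℝ {w : Fin n → E |
        ∃ l : Fin n → ℝ, (∀ j, 0 ≤ l j) ∧ ∑ j, l j ≤ 1 ∧ ∀ j, w j ∈ l j • P} := by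
      rintro w ⟨l, hl0, hl1, hl⟩ w' ⟨l', hl0', hl1', hl'⟩ α β hα hβ hαβ
      refine ⟨α • l + β • l', fun j => ?_, ?_, fun j => ?_⟩
      · exact add_nonneg (mul_nonneg hα (hl0 j)) (mul_nonneg hβ (hl0' j))
      · simp only [Pi.add_apply, Pi.smul_apply, smul_eq_mul, Finset.sum_add_distrib,
          ← Finset.mul_sum]
        nlinarith
      · simp only [Pi.add_apply, Pi.smul_apply, smul_eq_mul]
        rw [hP.add_smul (mul_nonneg hα (hl0 j)) (mul_nonneg hβ (hl0' j)), mul_smul, mul_smul]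
        exact Set.add_mem_add (Set.smul_mem_smul_set (hl j)) (Set.smul_mem_smul_set (hl' j))
    intro hw
    refine convexHull_min ?_ hconv hw
    rintro _ ⟨_, ⟨i, rfl⟩, v, hv, rfl⟩
    refine ⟨Pi.single i 1, fun j => ?_, by simp, fun j => ?_⟩
    · by_cases h : j = i
      · subst h; simp
      · simp [h]
    · by_cases h : j = i
      · subst h; simpa using hv
      · simp only [Pi.single_eq_of_ne h]
        exact ⟨0, h0, by simp⟩
  · rintro ⟨l, hl0, hl1, hl⟩
    choose p hp hpl using hl
    have hz : (0 : Fin n → E) ∈ freeSumPower P n :=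
      subset_convexHull ℝ _ (Set.mem_iUnion.mpr ⟨⟨0, hn⟩, 0, h0, by simp⟩)
    have := (convex_convexHull ℝ (⋃ i : Fin n, (fun v : E => (Pi.single i v : Fin n → E)) '' P)
      ).sum_mem (t := Finset.univ)
      (w := fun o : Option (Fin n) => o.elim (1 - ∑ j, l j) l)
      (z := fun o : Option (Fin n) => o.elim 0 fun j => Pi.single j (p j)) ?_ ?_ ?_
    · refine Eq.subst (motive := (· ∈ freeSumPower P n)) ?_ this
      funext i
      rw [Fintype.sum_option]
      simp only [Option.elim_none, Option.elim_some, smul_zero, zero_add, Finset.sum_apply,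
        Pi.smul_apply]
      rw [Finset.sum_eq_single i]
      · simpa using hpl i
      · intro j _ hj
        simp [hj.symm]
      · simp
    · rintro (_ | j) _
      · simpa using hl1
      · exact hl0 j
    · simp [Fintype.sum_option]
    · rintro (_ | j) _
      · exact hz
      · exact subset_convexHull ℝ _ (Set.mem_iUnion.mpr ⟨j, p j, hp j, rfl⟩)

theorem mem_smul_freeSumPower_iff (hP : Convex ℝ P) (h0 : (0 : E) ∈ P) {n : ℕ} (hn : 0 < n)
    {m : ℝ} (hm : 0 ≤ m) {w : Fin n → E} :
    w ∈ m • freeSumPower P n ↔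
      ∃ l : Fin n → ℝ, (∀ j, 0 ≤ l j) ∧ ∑ j, l j ≤ m ∧ ∀ j, w j ∈ l j • P := by
  constructor
  · rintro ⟨y, hy, rfl⟩
    obtain ⟨l, hl0, hl1, hl⟩ := (mem_freeSumPower_iff hP h0 hn).mp hy
    refine ⟨m • l, fun j => mul_nonneg hm (hl0 j), ?_, fun j => ?_⟩
    · simp only [Pi.smul_apply, smul_eq_mul, ← Finset.mul_sum]
      exact mul_le_of_le_one_right hm hl1
    · simp only [Pi.smul_apply, smul_eq_mul, mul_smul]
      exact Set.smul_mem_smul_set (hl j)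
  · rintro ⟨l, hl0, hl1, hl⟩
    rcases hm.eq_or_lt with rfl | hpos
    · have hz : ∀ j, l j = 0 := fun j => le_antisymm
        ((Finset.single_le_sum (fun j _ => hl0 j) (Finset.mem_univ j)).trans hl1) (hl0 j)
      refine ⟨0, (mem_freeSumPower_iff hP h0 hn).mpr ⟨0, by simp, by simp,
        fun j => ⟨0, h0, by simp⟩⟩, ?_⟩
      funext j
      obtain ⟨p, -, hp⟩ := hl j
      rw [← hp]
      simp [hz]
    · rw [Set.mem_smul_set_iff_inv_smul_mem₀ hpos.ne', mem_freeSumPower_iff hP h0 hn]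
      refine ⟨m⁻¹ • l, fun j => mul_nonneg (inv_nonneg.mpr hm) (hl0 j), ?_, fun j => ?_⟩
      · simp only [Pi.smul_apply, smul_eq_mul, ← Finset.mul_sum]
        rwa [inv_mul_le_one₀ hpos]
      · simp only [Pi.smul_apply, smul_eq_mul, mul_smul]
        exact Set.smul_mem_smul_set (hl j)

theorem polyDim_freeSumPower [FiniteDimensional ℝ E] (h0 : (0 : E) ∈ P)
    (hspan : Submodule.span ℝ P = ⊤) {n : ℕ} (hn : 0 < n) :
    polyDim (freeSumPower P n) = n * Module.finrank ℝ E := by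
  rw [polyDim_eq_finrank, Module.finrank_pi_fintype]
  · simp
  · exact subset_convexHull ℝ _ (Set.mem_iUnion.mpr ⟨⟨0, hn⟩, 0, h0, by simp⟩)
  · have hsingle : ∀ (j : Fin n) (v : E),
        (Pi.single j v : Fin n → E) ∈ Submodule.span ℝ (freeSumPower P n) := by
      intro j v
      have hv : v ∈ Submodule.span ℝ P := by rw [hspan]; trivial
      have hle : Submodule.span ℝ P ≤
          (Submodule.span ℝ (freeSumPower P n)).comap (LinearMap.single ℝ (fun _ => E) j) := by
        rw [Submodule.span_le]
        intro p hp
        exact Submodule.subset_span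
          (subset_convexHull ℝ _ (Set.mem_iUnion.mpr ⟨j, p, hp, rfl⟩))
      exact hle hv
    rw [eq_top_iff]
    rintro w -
    rw [← Finset.univ_sum_single w]
    exact Submodule.sum_mem _ fun j _ => hsingle j _

end Geometry

/-! ### Both polynomials read off from the parametrisation -/

section Counts

variable {E : Type*} [AddCommGroup E] [Module ℝ E] {L : Submodule ℤ E} {P : Set E}
  {k d : ℕ} {e : Fin k → ℚ≥0} {Φ : Fin k × (Fin d → ℕ) → E}

theorem IsConeParam.latticeCount_smul (h : IsConeParam L P e Φ) (lam : ℚ≥0) :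
    latticeCount L ((lam : ℝ) • P) =
      {x : Fin k × (Fin d → ℕ) | e x.1 + (∑ j, x.2 j : ℕ) ≤ lam}.ncard := by
  rw [← Set.ncard_image_of_injective _ h.injective, latticeCount]
  congr 1
  have hval : ∀ x, Φ x ∈ (lam : ℝ) • P ↔ e x.1 + (∑ j, x.2 j : ℕ) ≤ lam := by
    intro x
    rw [h.mem_smul_iff x lam (NNRat.cast_nonneg lam)]
    exact_mod_cast Iff.rfl
  ext v
  constructor
  · rintro ⟨hv, hvL⟩
    obtain ⟨x, rfl⟩ := h.exists_eq v hvL lam (NNRat.cast_nonneg lam) hv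
    exact ⟨x, (hval x).mp hv, rfl⟩
  · rintro ⟨x, hx, rfl⟩
    exact ⟨(hval x).mpr hx, h.mem_lattice x⟩

theorem finite_setOf_le (e : Fin k → ℚ≥0) (d : ℕ) (lam : ℚ≥0) :
    {x : Fin k × (Fin d → ℕ) | e x.1 + (∑ j, x.2 j : ℕ) ≤ lam}.Finite := by
  refine (Set.finite_univ.prod (finite_setOf_sum_le (ι := Fin d) ⌊lam⌋₊)).subset ?_
  rintro ⟨i, n⟩ hx
  exact ⟨trivial, Nat.le_floor (le_add_self.trans hx)⟩

theorem IsConeParam.latticeCount_smul_natCast (h : IsConeParam L P e Φ) (m : ℕ) :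
    (latticeCount L ((m : ℝ) • P) : ℤ) = PowerSeries.coeff m
      ((∑ i, PowerSeries.X ^ ⌈e i⌉₊) * (PowerSeries.mk 1 : PowerSeries ℤ) ^ (d + 1)) := by
  have h1 := h.latticeCount_smul (m : ℚ≥0)
  rw [NNRat.cast_natCast] at h1
  have h2 : {x : Fin k × (Fin d → ℕ) | e x.1 + (∑ j, x.2 j : ℕ) ≤ (m : ℚ≥0)} =
      {x | x.2 ∈ (fun i => {n : Fin d → ℕ | ⌈e i⌉₊ + ∑ j, n j ≤ m}) x.1} := by
    ext x
    simp only [Set.mem_ofPred_eq]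
    rw [← Nat.ceil_add_natCast zero_le, Nat.ceil_le]
  have hfib : ∀ i, {n : Fin d → ℕ | ⌈e i⌉₊ + ∑ j, n j ≤ m}.Finite :=
    fun i => (finite_setOf_sum_le m).subset fun n (hn : _ ≤ m) => le_add_self.trans hn
  rw [h1, h2]
  refine (congrArg Nat.cast (ncard_fibers hfib)).trans ?_
  rw [Finset.sum_mul, map_sum, Nat.cast_sum]
  refine Finset.sum_congr rfl fun i _ => ?_
  rw [ncard_add_sum_le, Fintype.card_fin]

/-- Parametrising each component gives copies of ℕ^(nd) indexed by p, with gauge ∑ e (p j) plus an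
integer. As m is an integer, the fractional constant may be replaced by its ceiling. -/
theorem IsConeParam.latticeCount_freeSumPower (h : IsConeParam L P e Φ) (hP : Convex ℝ P)
    (h0 : (0 : E) ∈ P) {n : ℕ} (hn : 0 < n) (m : ℕ) :
    (latticeCount (latticePower L n) ((m : ℝ) • freeSumPower P n) : ℤ) = PowerSeries.coeff m
      ((∑ p : Fin n → Fin k, PowerSeries.X ^ ⌈∑ j, e (p j)⌉₊) *
        (PowerSeries.mk 1 : PowerSeries ℤ) ^ (n * d + 1)) := by
  let Ψ : (Fin n → Fin k) × (Fin n × Fin d → ℕ) → (Fin n → E) :=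
    fun x j => Φ (x.1 j, fun i => x.2 (j, i))
  have hΨ : Function.Injective Ψ := by
    rintro ⟨p, N⟩ ⟨p', N'⟩ hx
    have hj : ∀ j, p j = p' j ∧ (fun i => N (j, i)) = fun i => N' (j, i) := fun j =>
      Prod.mk_inj.mp (h.injective (congrFun hx j))
    refine Prod.mk_inj.mpr ⟨funext fun j => (hj j).1, funext fun ⟨j, i⟩ => ?_⟩
    exact congrFun (hj j).2 i
  have hset : ((m : ℝ) • freeSumPower P n) ∩ (latticePower L n : Set (Fin n → E)) =
      Ψ '' {x | x.2 ∈ (fun p : Fin n → Fin k =>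
        {N : Fin n × Fin d → ℕ | ⌈∑ j, e (p j)⌉₊ + ∑ i, N i ≤ m}) x.1} := by
    ext w
    have hval : ∀ x : (Fin n → Fin k) × (Fin n × Fin d → ℕ),
        (⌈∑ j, e (x.1 j)⌉₊ + ∑ i, x.2 i ≤ m ↔
          ∑ j, ((e (x.1 j) : ℝ) + (∑ i, x.2 (j, i) : ℕ)) ≤ m) := by
      intro x
      rw [← Nat.ceil_add_natCast zero_le, Nat.ceil_le, Fintype.sum_prod_type,
        Finset.sum_add_distrib, ← NNRat.cast_sum, ← Nat.cast_sum]
      exact_mod_cast Iff.rfl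
    constructor
    · rintro ⟨hw, hwL⟩
      obtain ⟨l, hl0, hl1, hl⟩ := (mem_smul_freeSumPower_iff hP h0 hn m.cast_nonneg).mp hw
      have hwL : ∀ j, w j ∈ L := fun j => (Submodule.mem_pi.mp hwL) j trivial
      choose x hx using fun j => h.exists_eq (w j) (hwL j) (l j) (hl0 j) (hl j)
      refine ⟨(fun j => (x j).1, fun i => (x i.1).2 i.2), ?_, funext hx⟩
      refine (hval _).mpr (le_trans (Finset.sum_le_sum fun j _ => ?_) hl1)
      refine (h.mem_smul_iff (x j) (l j) (hl0 j)).mp ?_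
      rw [hx]
      exact hl j
    · rintro ⟨x, hx, rfl⟩
      have hnn : ∀ j, 0 ≤ (e (x.1 j) : ℝ) + (∑ i, x.2 (j, i) : ℕ) := fun j => by positivity
      refine ⟨(mem_smul_freeSumPower_iff hP h0 hn m.cast_nonneg).mpr ⟨_, hnn, (hval x).mp hx,
        fun j => ?_⟩, Submodule.mem_pi.mpr fun j _ => h.mem_lattice _⟩
      exact (h.mem_smul_iff _ _ (hnn j)).mpr le_rfl
  have hfib : ∀ p : Fin n → Fin k,
      {N : Fin n × Fin d → ℕ | ⌈∑ j, e (p j)⌉₊ + ∑ i, N i ≤ m}.Finite :=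
    fun p => (finite_setOf_sum_le m).subset fun N (hN : _ ≤ m) => le_add_self.trans hN
  rw [latticeCount, hset, Set.ncard_image_of_injective _ hΨ]
  refine (congrArg Nat.cast (ncard_fibers hfib)).trans ?_
  rw [Finset.sum_mul, map_sum, Nat.cast_sum]
  refine Finset.sum_congr rfl fun p _ => ?_
  rw [ncard_add_sum_le, Fintype.card_prod, Fintype.card_fin, Fintype.card_fin]

theorem isHStar_unique {Q : Set E} {p q : Polynomial ℤ} (hp : IsHStar L Q p)
    (hq : IsHStar L Q q) : p = q :=
  Polynomial.coe_injective ℤ (hp.trans hq.symm)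

theorem IsHStar.hStar_eq {Q : Set E} {p : Polynomial ℤ} (hp : IsHStar L Q p) :
    hStar L Q = p := by
  have h : ∃ p, IsHStar L Q p := ⟨p, hp⟩
  rw [hStar, dif_pos h]
  exact isHStar_unique h.choose_spec hp

theorem isHStar_of_coeff {Q : Set E} {D : ℕ} (hD : polyDim Q = D) {p : Polynomial ℤ}
    (hp : ∀ m : ℕ, (latticeCount L ((m : ℝ) • Q) : ℤ) = PowerSeries.coeff m
      ((p : PowerSeries ℤ) * (PowerSeries.mk 1 : PowerSeries ℤ) ^ (D + 1))) :
    IsHStar L Q p := by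
  have : ehrhartSeries L Q =
      (p : PowerSeries ℤ) * (PowerSeries.mk 1 : PowerSeries ℤ) ^ (D + 1) := by
    ext m
    rw [ehrhartSeries, PowerSeries.coeff_mk, hp]
  rw [IsHStar, this, hD, mul_left_comm, ← mul_pow, mul_comm (1 - _),
    PowerSeries.mk_one_mul_one_sub_eq_one, one_pow, mul_one]

end Counts

theorem IsConeParam.isHStar {E : Type*} [AddCommGroup E] [Module ℝ E]
    {L : Submodule ℤ E} {P : Set E} {k : ℕ} {e : Fin k → ℚ≥0}
    {Φ : Fin k × (Fin (Module.finrank ℝ E) → ℕ) → E} (h : IsConeParam L P e Φ) (hP : IsFullLatticePolytope L P) :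
    IsHStar L P (∑ i, Polynomial.X ^ ⌈e i⌉₊) := by
  refine isHStar_of_coeff hP.polyDim_eq fun m => ?_
  rw [h.latticeCount_smul_natCast, ← Polynomial.coeToPowerSeries.ringHom_apply, map_sum]
  simp

theorem IsWeightedHStar.weightedHStar_eq {E : Type*} [NormedAddCommGroup E] [NormedSpace ℝ E]
    {L : Submodule ℤ E} {P : Set E} {p : FracPoly} (hp : IsWeightedHStar L P p) :
    weightedHStar L P = p := by
  have h : ∃ p, IsWeightedHStar L P p := ⟨p, hp⟩
  rw [weightedHStar, dif_pos h]
  ext lam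
  rw [h.choose_spec lam, hp lam]

section Formulas

variable {E : Type*} [NormedAddCommGroup E] [NormedSpace ℝ E] [FiniteDimensional ℝ E]
  {L : Submodule ℤ E} {P : Set E}
  {k : ℕ} {e : Fin k → ℚ≥0} {Φ : Fin k × (Fin (Module.finrank ℝ E) → ℕ) → E}

theorem IsConeParam.isHStar_freeSumPower (h : IsConeParam L P e Φ)
    (hP : IsFullLatticePolytope L P) {n : ℕ} (hn : 0 < n) :
    IsHStar (latticePower L n) (freeSumPower P n)
      (∑ p : Fin n → Fin k, Polynomial.X ^ ⌈∑ j, e (p j)⌉₊) := by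
  refine isHStar_of_coeff (polyDim_freeSumPower hP.zero_mem hP.span_eq_top hn) fun m => ?_
  rw [h.latticeCount_freeSumPower hP.convex hP.zero_mem hn,
    ← Polynomial.coeToPowerSeries.ringHom_apply, map_sum]
  simp

theorem IsConeParam.hStarPower_eq (h : IsConeParam L P e Φ)
    (hP : IsFullLatticePolytope L P) {n : ℕ} (hn : 0 < n) :
    hStarPower L P n = ∑ p : Fin n → Fin k, Polynomial.X ^ ⌈∑ j, e (p j)⌉₊ :=
  (h.isHStar_freeSumPower hP hn).hStar_eq

theorem IsConeParam.latticeCount_awayBoundary (h : IsConeParam L P e Φ)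
    (hP : IsFullLatticePolytope L P) (lam : ℚ≥0) :
    latticeCount L (awayBoundary P lam) =
      {x : Fin k × (Fin (Module.finrank ℝ E) → ℕ) | e x.1 + (∑ j, x.2 j : ℕ) = lam}.ncard := by
  rw [← Set.ncard_image_of_injective _ h.injective, latticeCount]
  congr 1
  have hmem : ∀ v, v ∈ awayBoundary P lam ↔ v ∈ (lam : ℝ) • P ∧
      ∀ μ : ℝ, 0 ≤ μ → μ < lam → v ∉ μ • P := by
    intro v
    have h0 := hP.zero_mem
    have h1 := hP.affineSpan_eq_top
    obtain ⟨S, -, hS⟩ := hP.exists_conv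
    rw [hS] at h0 h1 ⊢
    exact mem_awayBoundary_iff h0 h1
  ext v
  constructor
  · rintro ⟨hv, hvL⟩
    obtain ⟨hv1, hv2⟩ := (hmem v).mp hv
    obtain ⟨x, rfl⟩ := h.exists_eq v hvL lam (NNRat.cast_nonneg lam) hv1
    have hle := (h.mem_smul_iff x lam (NNRat.cast_nonneg lam)).mp hv1
    have hnn : 0 ≤ (e x.1 : ℝ) + (∑ j, x.2 j : ℕ) := by positivity
    have hge := not_lt.mp fun hlt => hv2 _ hnn hlt ((h.mem_smul_iff x _ hnn).mpr le_rfl)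
    refine ⟨x, ?_, rfl⟩
    have := hle.antisymm hge
    exact_mod_cast this
  · rintro ⟨x, hx, rfl⟩
    have hx : (e x.1 : ℝ) + (∑ j, x.2 j : ℕ) = lam := by
      rw [← (hx : e x.1 + (∑ j, x.2 j : ℕ) = lam)]
      push_cast; rfl
    refine ⟨(hmem _).mpr ⟨(h.mem_smul_iff x lam (NNRat.cast_nonneg lam)).mpr hx.le,
      fun μ hμ0 hμ hmμ => ?_⟩, h.mem_lattice x⟩
    have := (h.mem_smul_iff x μ hμ0).mp hmμ
    linarith

/-- The i-th copy of ℕ^d contributes t^(e i)/(1 - t)^d to the series of gauge levels. -/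
theorem IsConeParam.isWeightedHStar (h : IsConeParam L P e Φ) (hP : IsFullLatticePolytope L P) :
    IsWeightedHStar L P (∑ i, AddMonoidAlgebra.single (e i) 1) := by
  have hc : (fun mu => (latticeCount L (awayBoundary P mu) : ℤ)) =
      ∑ i, shiftSeries (e i) ((PowerSeries.mk 1 : PowerSeries ℤ) ^ Module.finrank ℝ E) := by
    funext lam
    have hfib : ∀ i, {n : Fin (Module.finrank ℝ E) → ℕ | e i + (∑ j, n j : ℕ) = lam}.Finite :=
      fun i => (finite_setOf_sum_le ⌊lam⌋₊).subset fun n (hn : e i + _ = lam) =>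
        Nat.le_floor (le_add_self.trans hn.le)
    have hn := ncard_fibers hfib
    simp only [Set.mem_ofPred_eq] at hn
    rw [h.latticeCount_awayBoundary hP, hn, Finset.sum_apply, Nat.cast_sum]
    refine Finset.sum_congr rfl fun i _ => ?_
    by_cases hm : ∃ m : ℕ, lam = e i + m
    · obtain ⟨m, rfl⟩ := hm
      rw [shiftSeries_add_nat, ← Fintype.card_fin (Module.finrank ℝ E), ← ncard_sum_eq,
        Fintype.card_fin]
      simp only [add_right_inj, Nat.cast_inj]
    · rw [shiftSeries_of_not _ hm]
      have : {n : Fin (Module.finrank ℝ E) → ℕ | e i + (∑ j, n j : ℕ) = lam} = ∅ := by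
        ext n
        simp only [Set.mem_ofPred_eq, Set.mem_empty_iff_false, iff_false]
        exact fun hn => hm ⟨_, hn.symm⟩
      rw [this, Set.ncard_empty, Nat.cast_zero]
  intro lam
  rw [hc, mulSeries_sum, hP.polyDim_eq]
  simp only [mulSeries_one_sub_single_pow, ← mul_pow]
  rw [mul_comm (1 - _), PowerSeries.mk_one_mul_one_sub_eq_one, one_pow]
  simp only [Finset.sum_apply, shiftSeries_one, AddMonoidAlgebra.coeff_sum,
    Finsupp.finsetSum_apply]

end Formulas

/-! ### Rounding estimates, bounds and limit -/

section Bounds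

theorem rpow_ceil_bounds_of_le_one {x : ℝ} (hx : 0 < x) (hx1 : x ≤ 1) {q : ℚ≥0} {r m : ℕ}
    (hr : 0 < r) (hq : (r : ℚ≥0) * q = m) :
    x ^ ⌈q⌉₊ ≤ x ^ (q : ℝ) ∧ x ^ (q : ℝ) ≤ x ^ (1 / (r : ℝ) - 1) * x ^ ⌈q⌉₊ := by
  have hr' : (0 : ℝ) < r := by exact_mod_cast hr
  have hq' : (r : ℝ) * q = m := by exact_mod_cast hq
  have h1 : (q : ℝ) ≤ ⌈q⌉₊ := by exact_mod_cast Nat.le_ceil q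
  have h2 : (⌈q⌉₊ : ℝ) < q + 1 := by exact_mod_cast Nat.ceil_lt_add_one (zero_le (a := q))
  -- From ⌈q⌉ < q + 1, multiplied by r: both sides are integers, so the strict inequality gains 1,
  -- which is the 1/r in the exponent.
  have h3 : r * ⌈q⌉₊ + 1 ≤ m + r := by
    have : (r : ℝ) * ⌈q⌉₊ < m + r := by nlinarith
    have : r * ⌈q⌉₊ < m + r := by exact_mod_cast this
    omega
  have h3' : (r : ℝ) * ⌈q⌉₊ + 1 ≤ m + r := by exact_mod_cast h3
  have h4 : 1 / (r : ℝ) - 1 + ⌈q⌉₊ ≤ q := by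
    rw [← mul_le_mul_iff_right₀ hr', mul_add, mul_sub, mul_one_div_cancel hr'.ne', hq']
    linarith
  rw [← Real.rpow_natCast x, ← Real.rpow_add hx]
  exact ⟨Real.rpow_le_rpow_of_exponent_ge hx hx1 h1, Real.rpow_le_rpow_of_exponent_ge hx hx1 h4⟩

theorem rpow_ceil_bounds_of_one_le {x : ℝ} (hx : 1 ≤ x) {q : ℚ≥0} {r m : ℕ}
    (hr : 0 < r) (hq : (r : ℚ≥0) * q = m) :
    x ^ (q : ℝ) ≤ x ^ ⌈q⌉₊ ∧ x ^ ⌈q⌉₊ ≤ x ^ (1 - 1 / (r : ℝ)) * x ^ (q : ℝ) := by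
  have hx0 : 0 < x := by linarith
  obtain ⟨h1, h2⟩ := rpow_ceil_bounds_of_le_one (inv_pos.mpr hx0) (inv_le_one_of_one_le₀ hx) hr hq
  have hA : 0 < x ^ (q : ℝ) := Real.rpow_pos_of_pos hx0 _
  have hB : 0 < x ^ ⌈q⌉₊ := pow_pos hx0 _
  have hC : 0 < x ^ (1 - 1 / (r : ℝ)) := Real.rpow_pos_of_pos hx0 _
  rw [inv_pow, Real.inv_rpow hx0.le] at h1
  rw [inv_pow, Real.inv_rpow hx0.le, Real.inv_rpow hx0.le, ← Real.rpow_neg hx0.le (_ - 1),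
    neg_sub] at h2
  refine ⟨(inv_le_inv₀ hB hA).mp h1, ?_⟩
  rw [← div_eq_mul_inv, le_div_iff₀ hB, inv_mul_le_iff₀ hA] at h2
  linarith

/-- Squeeze, using c^(1/n) → 1 for fixed c > 0. -/
theorem tendsto_rpow_one_div_of_bounds {w c₁ c₂ : ℝ} (hw : 0 < w) (hc₁ : 0 < c₁) (hc₂ : 0 < c₂)
    {h : ℕ → ℝ} (h1 : ∀ n : ℕ, 0 < n → c₁ * w ^ n ≤ h n) (h2 : ∀ n : ℕ, 0 < n → h n ≤ c₂ * w ^ n) :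
    Filter.Tendsto (fun n : ℕ => h n ^ (1 / (n : ℝ))) Filter.atTop (𝓝 w) := by
  have hlim : ∀ c : ℝ, 0 < c → Filter.Tendsto (fun n : ℕ => (c * w ^ n) ^ (1 / (n : ℝ)))
      Filter.atTop (𝓝 w) := by
    intro c hc
    have h0 : Filter.Tendsto (fun n : ℕ => c ^ (1 / (n : ℝ)) * w) Filter.atTop
        (𝓝 (c ^ (0 : ℝ) * w)) :=
      ((Real.continuousAt_const_rpow hc.ne').tendsto.comp
        (tendsto_one_div_atTop_nhds_zero_nat (𝕜 := ℝ))).mul_const w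
    rw [Real.rpow_zero, one_mul] at h0
    refine h0.congr' ?_
    filter_upwards [Filter.eventually_gt_atTop 0] with n hn
    rw [Real.mul_rpow hc.le (pow_nonneg hw.le n), one_div,
      Real.pow_rpow_inv_natCast hw.le (by omega)]
  refine tendsto_of_tendsto_of_tendsto_of_le_of_le' (hlim c₁ hc₁) (hlim c₂ hc₂) ?_ ?_
  · filter_upwards [Filter.eventually_gt_atTop 0] with n hn
    exact Real.rpow_le_rpow (by positivity) (h1 n hn) (by positivity)
  · filter_upwards [Filter.eventually_gt_atTop 0] with n hn
    exact Real.rpow_le_rpow (le_trans (by positivity) (h1 n hn)) (h2 n hn) (by positivity)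

end Bounds

section Ceil

/-- The polynomial obtained from a polynomial with fractional exponents by rounding up all
the exponents. -/
noncomputable def ceilPoly (p : FracPoly) : Polynomial ℤ :=
  p.coeff.sum fun q a => Polynomial.monomial ⌈q⌉₊ a

theorem ceilPoly_sum_single {ι : Type*} (s : Finset ι) (q : ι → ℚ≥0) :
    ceilPoly (∑ i ∈ s, AddMonoidAlgebra.single (q i) 1) = ∑ i ∈ s, Polynomial.X ^ ⌈q i⌉₊ := by
  classical
  induction s using Finset.induction_on with
  | empty => simp [ceilPoly]
  | insert i s hi ih =>
    rw [Finset.sum_insert hi, Finset.sum_insert hi, ← ih]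
    unfold ceilPoly
    rw [AddMonoidAlgebra.coeff_add, Finsupp.sum_add_index' (by simp) (by simp),
      AddMonoidAlgebra.coeff_single, Finsupp.sum_single_index (by simp),
      Polynomial.X_pow_eq_monomial]

theorem sum_single_pow {k : ℕ} (e : Fin k → ℚ≥0) (n : ℕ) :
    (∑ i, AddMonoidAlgebra.single (e i) 1 : FracPoly) ^ n =
      ∑ p : Fin n → Fin k, AddMonoidAlgebra.single (∑ j, e (p j)) 1 := by
  rw [Fintype.sum_pow]
  refine Finset.sum_congr rfl fun p _ => ?_
  simp

end Ceil

/-- The origin is a lattice point of gauge 0. In particular k > 0. -/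
theorem IsConeParam.exists_eq_zero {E : Type*} [AddCommGroup E] [Module ℝ E]
    {L : Submodule ℤ E} {P : Set E} {k d : ℕ} {e : Fin k → ℚ≥0}
    {Φ : Fin k × (Fin d → ℕ) → E} (h : IsConeParam L P e Φ) (hP : IsFullLatticePolytope L P) :
    ∃ i, e i = 0 := by
  have h0 : (0 : E) ∈ (0 : ℝ) • P := ⟨0, hP.zero_mem, by simp⟩
  obtain ⟨x, hx⟩ := h.exists_eq 0 L.zero_mem 0 le_rfl h0
  have := (h.mem_smul_iff x 0 le_rfl).mp (by rwa [hx])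
  refine ⟨x.1, ?_⟩
  have h1 : (0 : ℝ) ≤ (∑ j, x.2 j : ℕ) := Nat.cast_nonneg _
  have h2 : (0 : ℝ) ≤ e x.1 := NNRat.cast_nonneg _
  have h3 : (e x.1 : ℝ) = 0 := by linarith
  exact_mod_cast h3

section Single

variable {E : Type*} [NormedAddCommGroup E] [NormedSpace ℝ E] [FiniteDimensional ℝ E]
  {L : Submodule ℤ E} {P : Set E}
  {k : ℕ} {e : Fin k → ℚ≥0} {Φ : Fin k × (Fin (Module.finrank ℝ E) → ℕ) → E}

theorem IsConeParam.weightedHStar_eq (h : IsConeParam L P e Φ) (hP : IsFullLatticePolytope L P) :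
    weightedHStar L P = ∑ i, AddMonoidAlgebra.single (e i) 1 :=
  (h.isWeightedHStar hP).weightedHStar_eq

theorem IsConeParam.eval_one_hStarPower (h : IsConeParam L P e Φ)
    (hP : IsFullLatticePolytope L P) {n : ℕ} (hn : 0 < n) :
    (hStarPower L P n).eval 1 = (k : ℤ) ^ n := by
  rw [h.hStarPower_eq hP hn, Polynomial.eval_finsetSum]
  simp

theorem IsConeParam.evalReal_weightedHStar (h : IsConeParam L P e Φ)
    (hP : IsFullLatticePolytope L P) (x : ℝ) :
    (weightedHStar L P).evalReal x = ∑ i, x ^ (e i : ℝ) := by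
  rw [h.weightedHStar_eq hP, evalReal_sum_single]

theorem IsConeParam.evalReal_weightedHStar_pow (h : IsConeParam L P e Φ)
    (hP : IsFullLatticePolytope L P) {x : ℝ} (hx : 0 < x) (n : ℕ) :
    (weightedHStar L P).evalReal x ^ n =
      ∑ p : Fin n → Fin k, x ^ ((∑ j, e (p j) : ℚ≥0) : ℝ) := by
  rw [h.evalReal_weightedHStar hP, Fintype.sum_pow]
  refine Finset.sum_congr rfl fun p _ => ?_
  rw [NNRat.cast_sum, Real.rpow_sum_of_pos hx]

theorem IsConeParam.hStarPowerEval_eq (h : IsConeParam L P e Φ)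
    (hP : IsFullLatticePolytope L P) {n : ℕ} (hn : 0 < n) (x : ℝ) :
    hStarPowerEval L P n x = ∑ p : Fin n → Fin k, x ^ ⌈∑ j, e (p j)⌉₊ := by
  rw [hStarPowerEval, h.hStarPower_eq hP hn]
  simp

theorem IsConeParam.hStarPower_eq_ceilPoly (h : IsConeParam L P e Φ)
    (hP : IsFullLatticePolytope L P) {n : ℕ} (hn : 0 < n) :
    hStarPower L P n = ceilPoly (weightedHStar L P ^ n) := by
  rw [h.hStarPower_eq hP hn, h.weightedHStar_eq hP, sum_single_pow, ceilPoly_sum_single]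

theorem exists_nat_mul_sum {k n r : ℕ} {e : Fin k → ℚ≥0}
    (he : ∀ i, ∃ m : ℕ, (r : ℚ≥0) * e i = m) (p : Fin n → Fin k) :
    ∃ m : ℕ, (r : ℚ≥0) * ∑ j, e (p j) = m := by
  choose m hm using he
  refine ⟨∑ j, m (p j), ?_⟩
  rw [Finset.mul_sum]
  push_cast
  exact Finset.sum_congr rfl fun j _ => hm _

variable [DiscreteTopology L]

theorem bounds_of_le_one (hP : IsFullLatticePolytope L P) {x : ℝ} (hx : 0 < x) (hx1 : x ≤ 1)
    {n : ℕ} (hn : 0 < n) :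
    hStarPowerEval L P n x ≤ (weightedHStar L P).evalReal x ^ n ∧
      (weightedHStar L P).evalReal x ^ n ≤
        x ^ (1 / (dualIndex L P : ℝ) - 1) * hStarPowerEval L P n x := by
  obtain ⟨k, e, Φ, h, hden⟩ := exists_isConeParam hP
  obtain ⟨hr, -⟩ := isLeast_dualIndex hP
  have hb := fun p : Fin n → Fin k =>
    rpow_ceil_bounds_of_le_one hx hx1 hr.1 (exists_nat_mul_sum (hden _ hr) p).choose_spec
  rw [h.hStarPowerEval_eq hP hn, h.evalReal_weightedHStar_pow hP hx, Finset.mul_sum]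
  exact ⟨Finset.sum_le_sum fun p _ => (hb p).1, Finset.sum_le_sum fun p _ => (hb p).2⟩

theorem bounds_of_one_le (hP : IsFullLatticePolytope L P) {x : ℝ} (hx : 1 ≤ x)
    {n : ℕ} (hn : 0 < n) :
    (weightedHStar L P).evalReal x ^ n ≤ hStarPowerEval L P n x ∧
      hStarPowerEval L P n x ≤
        x ^ (1 - 1 / (dualIndex L P : ℝ)) * (weightedHStar L P).evalReal x ^ n := by
  obtain ⟨k, e, Φ, h, hden⟩ := exists_isConeParam hP
  obtain ⟨hr, -⟩ := isLeast_dualIndex hP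
  have hb := fun p : Fin n → Fin k =>
    rpow_ceil_bounds_of_one_le hx hr.1 (exists_nat_mul_sum (hden _ hr) p).choose_spec
  rw [h.hStarPowerEval_eq hP hn, h.evalReal_weightedHStar_pow hP (by linarith), Finset.mul_sum]
  exact ⟨Finset.sum_le_sum fun p _ => (hb p).1, Finset.sum_le_sum fun p _ => (hb p).2⟩

theorem evalReal_weightedHStar_pos (hP : IsFullLatticePolytope L P) {x : ℝ} (hx : 0 < x) :
    0 < (weightedHStar L P).evalReal x := by
  obtain ⟨k, e, Φ, h, -⟩ := exists_isConeParam hP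
  obtain ⟨i, -⟩ := h.exists_eq_zero hP
  rw [h.evalReal_weightedHStar hP]
  exact Finset.sum_pos (fun i _ => Real.rpow_pos_of_pos hx _) ⟨i, Finset.mem_univ i⟩

theorem tendsto_hStarPowerEval (hP : IsFullLatticePolytope L P) {x : ℝ} (hx : 0 < x) :
    Filter.Tendsto (fun n : ℕ => hStarPowerEval L P n x ^ (1 / (n : ℝ))) Filter.atTop
      (𝓝 ((weightedHStar L P).evalReal x)) := by
  have hw := evalReal_weightedHStar_pos hP hx
  rcases le_total x 1 with hx1 | hx1
  · have hC := Real.rpow_pos_of_pos hx (1 / (dualIndex L P : ℝ) - 1)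
    refine tendsto_rpow_one_div_of_bounds hw (inv_pos.mpr hC) one_pos (fun n hn => ?_)
      fun n hn => ?_
    · rw [inv_mul_le_iff₀ hC]
      exact (bounds_of_le_one hP hx hx1 hn).2
    · rw [one_mul]
      exact (bounds_of_le_one hP hx hx1 hn).1
  · refine tendsto_rpow_one_div_of_bounds hw one_pos
      (Real.rpow_pos_of_pos hx (1 - 1 / (dualIndex L P : ℝ))) (fun n hn => ?_) fun n hn => ?_
    · rw [one_mul]
      exact (bounds_of_one_le hP hx1 hn).1
    · exact (bounds_of_one_le hP hx1 hn).2

end Single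

/-! ### Dimension and weighted polynomial recovered from point counts -/

section Ehrhart

theorem IsHStar.latticeCount_smul {E : Type*} [AddCommGroup E] [Module ℝ E] {L : Submodule ℤ E}
    {Q : Set E} {p : Polynomial ℤ} (hp : IsHStar L Q p) (m : ℕ) :
    (latticeCount L ((m : ℝ) • Q) : ℤ) = PowerSeries.coeff m
      ((p : PowerSeries ℤ) * (PowerSeries.mk 1 : PowerSeries ℤ) ^ (polyDim Q + 1)) := by
  have hs : (latticeCount L ((m : ℝ) • Q) : ℤ) = PowerSeries.coeff m (ehrhartSeries L Q) := by
    rw [ehrhartSeries, PowerSeries.coeff_mk]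
  rw [hs, hp, mul_right_comm, ← mul_pow, mul_comm (1 - _), PowerSeries.mk_one_mul_one_sub_eq_one,
    one_pow, one_mul]

variable {E E' : Type*} [AddCommGroup E] [Module ℝ E] [AddCommGroup E'] [Module ℝ E']
  {L : Submodule ℤ E} {L' : Submodule ℤ E'} {Q : Set E} {Q' : Set E'} {p p' : Polynomial ℤ}

theorem ehrhartSeries_congr
    (h : ∀ m : ℕ, latticeCount L ((m : ℝ) • Q) = latticeCount L' ((m : ℝ) • Q')) :
    ehrhartSeries L Q = ehrhartSeries L' Q' := by
  ext m
  simp only [ehrhartSeries, PowerSeries.coeff_mk, h]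

/-- The pole of the Ehrhart series at t = 1 has order dim + 1 when the numerator does not vanish
there; a larger dimension for the same series would make p' divisible by 1 - t. -/
theorem polyDim_le_of_latticeCount_eq (hp : IsHStar L Q p) (hp' : IsHStar L' Q' p')
    (h1 : p'.eval 1 ≠ 0)
    (h : ∀ m : ℕ, latticeCount L ((m : ℝ) • Q) = latticeCount L' ((m : ℝ) • Q')) :
    polyDim Q' ≤ polyDim Q := by
  by_contra! hlt
  obtain ⟨c, hc⟩ := Nat.exists_eq_add_of_lt hlt
  apply h1
  have hpp : p' = (1 - Polynomial.X) ^ (c + 1) * p := by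
    apply Polynomial.coe_injective ℤ
    rw [hp', ← ehrhartSeries_congr h, hc, Polynomial.coe_mul, Polynomial.coe_pow,
      Polynomial.coe_sub, Polynomial.coe_one, Polynomial.coe_X, hp, ← mul_assoc, ← pow_add]
    congr 2
    ring
  rw [hpp]
  simp

theorem polyDim_eq_of_latticeCount_eq (hp : IsHStar L Q p) (hp' : IsHStar L' Q' p')
    (h1 : p.eval 1 ≠ 0) (h1' : p'.eval 1 ≠ 0)
    (h : ∀ m : ℕ, latticeCount L ((m : ℝ) • Q) = latticeCount L' ((m : ℝ) • Q')) :
    polyDim Q = polyDim Q' :=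
  (polyDim_le_of_latticeCount_eq hp' hp h1 fun m => (h m).symm).antisymm
    (polyDim_le_of_latticeCount_eq hp hp' h1' h)

end Ehrhart

section Dilates

/-- The right side involves only the weighted polynomial and d, so these two determine all rational
dilate counts. -/
theorem IsConeParam.latticeCount_smul_eq_sum {E : Type*} [AddCommGroup E] [Module ℝ E]
    {L : Submodule ℤ E} {P : Set E} {k d : ℕ} {e : Fin k → ℚ≥0}
    {Φ : Fin k × (Fin d → ℕ) → E} (h : IsConeParam L P e Φ) (lam : ℚ≥0) :
    (latticeCount L ((lam : ℝ) • P) : ℤ) =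
      FracPoly.mulSeries (∑ i, AddMonoidAlgebra.single (e i) 1)
        (fun mu => ({n : Fin d → ℕ | (∑ j, n j : ℕ) ≤ mu}.ncard : ℤ)) lam := by
  have hsum : ∀ (s : Finset (Fin k)) (c : ℚ≥0 → ℤ),
      FracPoly.mulSeries (∑ i ∈ s, AddMonoidAlgebra.single (e i) 1) c lam =
        ∑ i ∈ s, if e i ≤ lam then c (lam - e i) else 0 := by
    classical
    intro s c
    induction s using Finset.induction_on with
    | empty => simp [mulSeries_zero]
    | insert i s hi ih =>
      rw [Finset.sum_insert hi, Finset.sum_insert hi, mulSeries_add, ih, mulSeries_single,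
        one_mul]
  have hfib : ∀ i, {n : Fin d → ℕ | e i + (∑ j, n j : ℕ) ≤ lam}.Finite := fun i =>
    (finite_setOf_sum_le ⌊lam⌋₊).subset fun n hn => Nat.le_floor (le_add_self.trans hn)
  rw [h.latticeCount_smul, hsum]
  refine (congrArg Nat.cast (ncard_fibers hfib)).trans ?_
  rw [Nat.cast_sum]
  refine Finset.sum_congr rfl fun i _ => ?_
  split_ifs with hi
  · congr 2
    ext n
    exact (le_tsub_iff_left hi).symm
  · have : {n : Fin d → ℕ | e i + (∑ j, n j : ℕ) ≤ lam} = ∅ := by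
      ext n
      simp only [Set.mem_ofPred_eq, Set.mem_empty_iff_false, iff_false]
      exact fun hn => hi (le_self_add.trans hn)
    rw [this, Set.ncard_empty, Nat.cast_zero]

theorem lt_iff_le_ceil_sub_one_div {R m : ℕ} (hR : 0 < R) {v lam : ℚ≥0}
    (hv : (R : ℚ≥0) * v = m) (hlam : 0 < lam) :
    v < lam ↔ v ≤ ((⌈(R : ℚ≥0) * lam⌉₊ - 1 : ℕ) : ℚ≥0) / R := by
  have hR' : (0 : ℚ≥0) < R := by exact_mod_cast hR
  have hc : 0 < ⌈(R : ℚ≥0) * lam⌉₊ := Nat.ceil_pos.mpr (mul_pos hR' hlam)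
  rw [le_div_iff₀ hR', mul_comm v, hv, Nat.cast_le, ← mul_lt_mul_iff_right₀ hR', hv,
    ← Nat.lt_ceil]
  omega

/-- All gauges of lattice points lie in (1/R)ℕ, so gauge < λ means gauge at most (⌈Rλ⌉ - 1)/R, the
largest element of (1/R)ℕ below λ. The count at gauge λ is thus a difference of two dilate counts.
-/
theorem IsConeParam.latticeCount_smul_eq_add {E : Type*} [NormedAddCommGroup E] [NormedSpace ℝ E]
    [FiniteDimensional ℝ E] {L : Submodule ℤ E} {P : Set E} {k : ℕ} {e : Fin k → ℚ≥0}
    {Φ : Fin k × (Fin (Module.finrank ℝ E) → ℕ) → E} (h : IsConeParam L P e Φ)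
    (hP : IsFullLatticePolytope L P) {R : ℕ} (hR : 0 < R)
    (he : ∀ i, ∃ m : ℕ, (R : ℚ≥0) * e i = m) {lam : ℚ≥0} (hlam : 0 < lam) :
    latticeCount L ((lam : ℝ) • P) = latticeCount L (awayBoundary P lam) +
      latticeCount L (((((⌈(R : ℚ≥0) * lam⌉₊ - 1 : ℕ) : ℚ≥0) / R : ℚ≥0) : ℝ) • P) := by
  have hfin : {x : Fin k × (Fin (Module.finrank ℝ E) → ℕ) |
      e x.1 + (∑ j, x.2 j : ℕ) = lam}.Finite :=
    (finite_setOf_le e _ lam).subset fun x hx => le_of_eq hx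
  rw [h.latticeCount_smul, h.latticeCount_smul, h.latticeCount_awayBoundary hP,
    ← Set.ncard_union_eq ?_ hfin
      (finite_setOf_le e _ _)]
  · congr 1
    ext x
    obtain ⟨m, hm⟩ := he x.1
    have hv : (R : ℚ≥0) * (e x.1 + (∑ j, x.2 j : ℕ)) = (m + R * ∑ j, x.2 j : ℕ) := by
      rw [mul_add, hm]; push_cast; rfl
    simp only [Set.mem_ofPred_eq, Set.mem_union]
    rw [← lt_iff_le_ceil_sub_one_div hR hv hlam, le_iff_eq_or_lt]
  · rw [Set.disjoint_left]
    intro x hx hx'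
    obtain ⟨m, hm⟩ := he x.1
    have hv : (R : ℚ≥0) * (e x.1 + (∑ j, x.2 j : ℕ)) = (m + R * ∑ j, x.2 j : ℕ) := by
      rw [mul_add, hm]; push_cast; rfl
    exact absurd hx ((lt_iff_le_ceil_sub_one_div hR hv hlam).mpr hx').ne

end Dilates

/-! ### Comparison of two polytopes -/

section Comparison

variable {E E' : Type*} [NormedAddCommGroup E] [NormedSpace ℝ E] [FiniteDimensional ℝ E]
  [NormedAddCommGroup E'] [NormedSpace ℝ E'] [FiniteDimensional ℝ E']
  {L : Submodule ℤ E} [DiscreteTopology L] {L' : Submodule ℤ E'} [DiscreteTopology L']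
  {P : Set E} {P' : Set E'}

theorem weightedHStar_eq_iff_hStarPower_eq (hP : IsFullLatticePolytope L P)
    (hP' : IsFullLatticePolytope L' P') :
    weightedHStar L P = weightedHStar L' P' ↔
      ∀ n : ℕ, 0 < n → hStarPower L P n = hStarPower L' P' n := by
  constructor
  · intro hW n hn
    obtain ⟨k, e, Φ, h, -⟩ := exists_isConeParam hP
    obtain ⟨k', e', Φ', h', -⟩ := exists_isConeParam hP'
    rw [h.hStarPower_eq_ceilPoly hP hn, h'.hStarPower_eq_ceilPoly hP' hn, hW]
  · intro hn
    refine eq_of_evalReal_eq fun x hx => tendsto_nhds_unique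
      ((tendsto_hStarPowerEval hP hx).congr' ?_) (tendsto_hStarPowerEval hP' hx)
    filter_upwards [Filter.eventually_gt_atTop 0] with n hn0
    rw [hStarPowerEval, hn n hn0, hStarPowerEval]

/-- Evaluation at 1 gives k^n, which labels the members of the set by n once k = k' ≥ 2. Equality of
k and k' holds because each is a positive power of the other. -/
theorem weightedHStar_eq_iff_image_eq (hP : IsFullLatticePolytope L P)
    (hP' : IsFullLatticePolytope L' P') :
    weightedHStar L P = weightedHStar L' P' ↔
      hStarPower L P '' {n | 0 < n} = hStarPower L' P' '' {n | 0 < n} := by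
  constructor
  · intro hW
    exact Set.image_congr ((weightedHStar_eq_iff_hStarPower_eq hP hP').mp hW)
  · intro himg
    obtain ⟨k, e, Φ, h, -⟩ := exists_isConeParam hP
    obtain ⟨k', e', Φ', h', -⟩ := exists_isConeParam hP'
    obtain ⟨i, hi⟩ := h.exists_eq_zero hP
    obtain ⟨i', hi'⟩ := h'.exists_eq_zero hP'
    have hk : 0 < k := i.pos
    have hk' : 0 < k' := i'.pos
    have hpow : ∀ n : ℕ, 0 < n → ∃ m : ℕ, 0 < m ∧ k ^ n = k' ^ m ∧
        hStarPower L P n = hStarPower L' P' m := by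
      intro n hn
      obtain ⟨m, hm, hmn⟩ : hStarPower L P n ∈ hStarPower L' P' '' {n | 0 < n} :=
        himg ▸ Set.mem_image_of_mem _ hn
      have := congrArg (Polynomial.eval 1) hmn
      rw [h.eval_one_hStarPower hP hn, h'.eval_one_hStarPower hP' hm] at this
      exact ⟨m, hm, by exact_mod_cast this.symm, hmn.symm⟩
    have hle : k' ≤ k := by
      obtain ⟨m, hm, hkm, -⟩ := hpow 1 one_pos
      rw [pow_one] at hkm
      rw [hkm]
      exact Nat.le_self_pow hm.ne' k'
    have hle' : k ≤ k' := by
      obtain ⟨m, hm, hmn⟩ : hStarPower L' P' 1 ∈ hStarPower L P '' {n | 0 < n} :=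
        himg ▸ Set.mem_image_of_mem _ (Nat.one_pos)
      have := congrArg (Polynomial.eval 1) hmn
      rw [h.eval_one_hStarPower hP hm, h'.eval_one_hStarPower hP' one_pos, pow_one] at this
      have : k ^ m = k' := by exact_mod_cast this
      rw [← this]
      exact Nat.le_self_pow hm.ne' k
    obtain rfl := hle.antisymm hle'
    -- For k = 1 the labels are lost, but the only exponent is 0 and both weighted polynomials are
    -- 1.
    rcases (Nat.succ_le_of_lt hk).eq_or_lt with h1 | h1
    · obtain rfl : k' = 1 := h1.symm
      rw [h.weightedHStar_eq hP, h'.weightedHStar_eq hP']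
      refine Finset.sum_congr rfl fun j _ => ?_
      rw [Subsingleton.elim j i, hi, Subsingleton.elim i i', hi']
    · rw [weightedHStar_eq_iff_hStarPower_eq hP hP']
      intro n hn
      obtain ⟨m, -, hkm, hm⟩ := hpow n hn
      obtain rfl := Nat.pow_right_injective h1 hkm
      exact hm

theorem latticeCount_smul_eq_iff (hP : IsFullLatticePolytope L P)
    (hP' : IsFullLatticePolytope L' P') :
    (∀ lam : ℚ≥0, latticeCount L ((lam : ℝ) • P) = latticeCount L' ((lam : ℝ) • P')) ↔
      polyDim P = polyDim P' ∧ weightedHStar L P = weightedHStar L' P' := by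
  obtain ⟨r, hr⟩ := dualDenominators_nonempty hP
  obtain ⟨r', hr'⟩ := dualDenominators_nonempty hP'
  obtain ⟨k, e, Φ, h, he⟩ := exists_isConeParam hP
  obtain ⟨k', e', Φ', h', he'⟩ := exists_isConeParam hP'
  constructor
  · intro hc
    have hk : (∑ i, Polynomial.X ^ ⌈e i⌉₊ : Polynomial ℤ).eval 1 ≠ 0 := by
      have := (h.exists_eq_zero hP).choose.pos.ne'
      simpa [Polynomial.eval_finsetSum] using this
    have hk' : (∑ i, Polynomial.X ^ ⌈e' i⌉₊ : Polynomial ℤ).eval 1 ≠ 0 := by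
      have := (h'.exists_eq_zero hP').choose.pos.ne'
      simpa [Polynomial.eval_finsetSum] using this
    have hd : polyDim P = polyDim P' :=
      polyDim_eq_of_latticeCount_eq (h.isHStar hP) (h'.isHStar hP') hk hk' fun m => by
        simpa using hc (m : ℚ≥0)
    refine ⟨hd, ?_⟩
    have haway : ∀ lam : ℚ≥0, latticeCount L (awayBoundary P lam) =
        latticeCount L' (awayBoundary P' lam) := by
      intro lam
      rcases (zero_le (a := lam)).eq_or_lt with rfl | hlam
      · have h0 := hc 0
        rw [h.latticeCount_smul, h'.latticeCount_smul] at h0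
        rw [h.latticeCount_awayBoundary hP, h'.latticeCount_awayBoundary hP']
        simpa only [nonpos_iff_eq_zero] using h0
      -- A common denominator for both polytopes makes the smaller dilation factor the same on both
      -- sides.
      · have h1 := h.latticeCount_smul_eq_add hP (R := r * r') (Nat.mul_pos hr.1 hr'.1)
          (fun i => by
            obtain ⟨m, hm⟩ := he r hr i
            exact ⟨r' * m, by push_cast; rw [← hm]; ring⟩) hlam
        have h2 := h'.latticeCount_smul_eq_add hP' (R := r * r') (Nat.mul_pos hr.1 hr'.1)
          (fun i => by
            obtain ⟨m, hm⟩ := he' r' hr' i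
            exact ⟨r * m, by push_cast; rw [← hm]; ring⟩) hlam
        rw [hc, hc, h2] at h1
        exact (Nat.add_right_cancel h1).symm
    refine IsWeightedHStar.weightedHStar_eq fun lam => ?_
    rw [hd]
    simp only [haway]
    rw [h'.weightedHStar_eq hP']
    exact h'.isWeightedHStar hP' lam
  · rintro ⟨hd, hW⟩ lam
    rw [hP.polyDim_eq, hP'.polyDim_eq] at hd
    rw [h.weightedHStar_eq hP, h'.weightedHStar_eq hP'] at hW
    have h1 := h.latticeCount_smul_eq_sum lam
    have h2 := h'.latticeCount_smul_eq_sum lam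
    rw [hW, hd, ← h2] at h1
    exact_mod_cast h1

theorem isHStar_hStarPower (hP : IsFullLatticePolytope L P) {n : ℕ} (hn : 0 < n) :
    IsHStar (latticePower L n) (freeSumPower P n) (hStarPower L P n) := by
  obtain ⟨k, e, Φ, h, -⟩ := exists_isConeParam hP
  rw [h.hStarPower_eq hP hn]
  exact h.isHStar_freeSumPower hP hn

theorem eval_one_hStarPower_ne_zero (hP : IsFullLatticePolytope L P) {n : ℕ} (hn : 0 < n) :
    (hStarPower L P n).eval 1 ≠ 0 := by
  obtain ⟨k, e, Φ, h, -⟩ := exists_isConeParam hP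
  rw [h.eval_one_hStarPower hP hn]
  have := (h.exists_eq_zero hP).choose.pos.ne'
  exact pow_ne_zero _ (by exact_mod_cast this)

theorem latticeCount_freeSumPower_eq_iff (hP : IsFullLatticePolytope L P)
    (hP' : IsFullLatticePolytope L' P') :
    (∀ n : ℕ, 0 < n → ∀ m : ℕ,
      latticeCount (latticePower L n) ((m : ℝ) • freeSumPower P n) =
        latticeCount (latticePower L' n) ((m : ℝ) • freeSumPower P' n)) ↔
      polyDim P = polyDim P' ∧ weightedHStar L P = weightedHStar L' P' := by
  have hdim : ∀ n : ℕ, 0 < n → polyDim (freeSumPower P n) = n * polyDim P := fun n hn => by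
    rw [polyDim_freeSumPower hP.zero_mem hP.span_eq_top hn, hP.polyDim_eq]
  have hdim' : ∀ n : ℕ, 0 < n → polyDim (freeSumPower P' n) = n * polyDim P' := fun n hn => by
    rw [polyDim_freeSumPower hP'.zero_mem hP'.span_eq_top hn, hP'.polyDim_eq]
  constructor
  · intro hc
    have hd : polyDim P = polyDim P' := by
      have := polyDim_eq_of_latticeCount_eq (isHStar_hStarPower hP one_pos)
        (isHStar_hStarPower hP' one_pos) (eval_one_hStarPower_ne_zero hP one_pos)
        (eval_one_hStarPower_ne_zero hP' one_pos) (hc 1 one_pos)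
      rwa [hdim 1 one_pos, hdim' 1 one_pos, one_mul, one_mul] at this
    refine ⟨hd, (weightedHStar_eq_iff_hStarPower_eq hP hP').mpr fun n hn => ?_⟩
    apply Polynomial.coe_injective ℤ
    rw [isHStar_hStarPower hP hn, isHStar_hStarPower hP' hn, ehrhartSeries_congr (hc n hn),
      hdim n hn, hdim' n hn, hd]
  · rintro ⟨hd, hW⟩ n hn m
    have h1 := (isHStar_hStarPower hP hn).latticeCount_smul m
    have h2 := (isHStar_hStarPower hP' hn).latticeCount_smul m
    rw [(weightedHStar_eq_iff_hStarPower_eq hP hP').mp hW n hn, hdim n hn, hd, ← hdim' n hn,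
      ← h2] at h1
    exact_mod_cast h1

theorem isWeightedHStar_weightedHStar (hP : IsFullLatticePolytope L P) :
    IsWeightedHStar L P (weightedHStar L P) := by
  obtain ⟨k, e, Φ, h, -⟩ := exists_isConeParam hP
  rw [h.weightedHStar_eq hP]
  exact h.isWeightedHStar hP

end Comparison

end FreeSum

open FreeSum in
theorem mainTheorem4
    {E : Type*} [NormedAddCommGroup E] [NormedSpace ℝ E] [FiniteDimensional ℝ E]
    (L : Submodule ℤ E) [DiscreteTopology L] [IsZLattice ℝ L]
    (P : Set E) (hP : IsFullLatticePolytope L P) :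
    -- the polynomials and the number in question are well defined
    IsWeightedHStar L P (weightedHStar L P) ∧
    (∀ n : ℕ, 0 < n → IsHStar (latticePower L n) (freeSumPower P n) (hStarPower L P n)) ∧
    IsLeast (dualDenominators L P) (dualIndex L P) ∧
    -- the two-sided bounds
    (∀ x : ℝ, 0 < x → x ≤ 1 → ∀ n : ℕ, 0 < n →
      hStarPowerEval L P n x ≤ (weightedHStar L P).evalReal x ^ n ∧
      (weightedHStar L P).evalReal x ^ n ≤
        x ^ (1 / (dualIndex L P : ℝ) - 1) * hStarPowerEval L P n x) ∧
    (∀ x : ℝ, 1 ≤ x → ∀ n : ℕ, 0 < n →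
      (weightedHStar L P).evalReal x ^ n ≤ hStarPowerEval L P n x ∧
      hStarPowerEval L P n x ≤
        x ^ (1 - 1 / (dualIndex L P : ℝ)) * (weightedHStar L P).evalReal x ^ n) ∧
    -- the limit
    (∀ x : ℝ, 0 < x →
      Filter.Tendsto (fun n : ℕ => hStarPowerEval L P n x ^ (1 / (n : ℝ))) Filter.atTop
        (𝓝 ((weightedHStar L P).evalReal x))) ∧
    -- comparison with any other full-dimensional lattice polytope containing the origin
    (∀ (E' : Type*) [NormedAddCommGroup E'] [NormedSpace ℝ E'] [FiniteDimensional ℝ E']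
      (L' : Submodule ℤ E') [DiscreteTopology L'] [IsZLattice ℝ L']
      (P' : Set E'), IsFullLatticePolytope L' P' →
      -- the weighted polynomial and the polynomials of the free sums determine each other,
      -- the latter given as a sequence or as a set
      (weightedHStar L P = weightedHStar L' P' ↔
        ∀ n : ℕ, 0 < n → hStarPower L P n = hStarPower L' P' n) ∧
      (weightedHStar L P = weightedHStar L' P' ↔
        hStarPower L P '' {n | 0 < n} = hStarPower L' P' '' {n | 0 < n}) ∧
      -- in a given dimension, the weighted polynomial and the lattice point counts
      -- of the rational dilates determine each other
      ((∀ lam : ℚ≥0, latticeCount L ((lam : ℝ) • P) = latticeCount L' ((lam : ℝ) • P')) ↔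
        polyDim P = polyDim P' ∧ weightedHStar L P = weightedHStar L' P') ∧
      -- the lattice point counts of the rational dilates and those of the integer dilates
      -- of the free sums determine each other
      ((∀ lam : ℚ≥0, latticeCount L ((lam : ℝ) • P) = latticeCount L' ((lam : ℝ) • P')) ↔
        ∀ n : ℕ, 0 < n → ∀ m : ℕ,
          latticeCount (latticePower L n) ((m : ℝ) • freeSumPower P n) =
            latticeCount (latticePower L' n) ((m : ℝ) • freeSumPower P' n))) := by
  refine ⟨isWeightedHStar_weightedHStar hP, fun n hn => isHStar_hStarPower hP hn,
    isLeast_dualIndex hP, fun x hx hx1 n hn => bounds_of_le_one hP hx hx1 hn,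
    fun x hx n hn => bounds_of_one_le hP hx hn, fun x hx => tendsto_hStarPowerEval hP hx, ?_⟩
  intro E' _ _ _ L' _ _ P' hP'
  exact ⟨weightedHStar_eq_iff_hStarPower_eq hP hP', weightedHStar_eq_iff_image_eq hP hP',
    latticeCount_smul_eq_iff hP hP',
    (latticeCount_smul_eq_iff hP hP').trans (latticeCount_freeSumPower_eq_iff hP hP').symm⟩
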